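/- **Theorem 4.1.** Let $R$ be a nonzero commutative ring with unity with $\operatorname{char}(R)\neq 2$, and put $R_2=\{r\in R : 2r=0\}$. Let $G$ be a nonabelian group of exponent $8$, let $\sigma: G\to\{\pm1\}$ be a nontrivial group homomorphism (an orientation), and let $N=\ker\sigma$. Let $\varphi_\sigma: RG\to RG$ be the map of the group ring given by $$\varphi_\sigma\Big(\sum_{x\in G}\alpha_x x\Big)=\sum_{x\in G}\alpha_x\,\sigma(x)\,x^{-1},$$ and let $(RG)^-_{\varphi_\sigma}=\{\alpha\in RG : \varphi_\sigma(\alpha)=-\alpha\}$. Then $(RG)^-_{\varphi_\sigma}$ is commutative (that is, $\alpha\beta=\beta\alpha$ for all $\alpha,\beta\in (RG)^-_{\varphi_\sigma}$) if and only if one of the following conditions holds: 1. $R_2=\{0\}$, $G= \langle g,h \mid g^8=1,\ h^2=g^4,\ gh=hg^3\rangle\times E$ and $N=\langle g^2, gh\rangle\times E$ for some elementary abelian $2$-group $E$; 2. $\operatorname{char}(R)=4$, $G= \langle g,h \mid g^8=1,\ h^2=g^4,\ gh=hg^{-1}\rangle\times E$ and $N=\langle g^2,h\rangle\times E$ or $N=\langle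 g^2,gh\rangle\times E$, for some elementary abelian $2$-group $E$. Here an elementary abelian $2$-group is an abelian group, possibly trivial or infinite, in which every element squares to $1$, and the equalities for $G$ and $N$ mean that some isomorphism from $G$ onto the direct product carries $N$ onto the stated subgroup. -/

import Mathlib

noncomputable section

namespace OrientedGroupRing

/-- The `R`-linear map `φ_σ` of the group ring `R[G]` attached to an orientation `σ : G → {±1}`:
`φ_σ (∑ α_g g) = ∑ α_g σ(g) g⁻¹`. -/
def phi {R G : Type*} [CommRing R] [Group G] (σ : G →* ℤˣ) :
    MonoidAlgebra R G →ₗ[R] MonoidAlgebra R G where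
  toFun x := x.coeff.sum fun g r => MonoidAlgebra.single g⁻¹ (r * (((σ g : ℤˣ) : ℤ) : R))
  map_add' x y := by
    rw [MonoidAlgebra.coeff_add]
    refine Finsupp.sum_add_index' (fun g => ?_) (fun g r s => ?_)
    · simp
    · rw [add_mul, MonoidAlgebra.single_add]
  map_smul' c x := by
    rw [MonoidAlgebra.coeff_smul, Finsupp.sum_smul_index' (fun g => by simp),
      RingHom.id_apply, Finsupp.smul_sum]
    refine Finsupp.sum_congr fun g _ => ?_
    rw [MonoidAlgebra.smul_single, smul_eq_mul, smul_eq_mul, mul_assoc]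

theorem phi_single {R G : Type*} [CommRing R] [Group G] (σ : G →* ℤˣ) (g : G) (r : R) :
    phi σ (MonoidAlgebra.single g r) =
      MonoidAlgebra.single g⁻¹ (r * (((σ g : ℤˣ) : ℤ) : R)) := by
  simp [phi]

/-- The set `(R[G])⁻` of antisymmetric elements of the group ring with respect to `φ_σ`. -/
def antisymmetric (R : Type*) {G : Type*} [CommRing R] [Group G] (σ : G →* ℤˣ) :
    Set (MonoidAlgebra R G) :=
  {x | phi σ x = -x}

/-- `(R[G])⁻` is commutative: any two antisymmetric elements commute. -/
def AntisymmetricCommutative (R : Type*) {G : Type*} [CommRing R] [Group G]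
    (σ : G →* ℤˣ) : Prop :=
  ∀ x ∈ antisymmetric R σ, ∀ y ∈ antisymmetric R σ, x * y = y * x

/-- The set `R₂ = {r ∈ R | 2 r = 0}`. -/
def twoTorsion (R : Type*) [CommRing R] : Set R := {r | 2 * r = 0}

/-- `E` is an elementary abelian `2`-group (possibly trivial or infinite). -/
def IsElementaryAbelianTwo (E : Type*) [CommGroup E] : Prop := ∀ x : E, x ^ 2 = 1

/-- The first free generator `g`. -/
abbrev fg : FreeGroup (Fin 2) := FreeGroup.of 0

/-- The second free generator `h`. -/
abbrev fh : FreeGroup (Fin 2) := FreeGroup.of 1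

/-- The relators of `⟨g, h ∣ g⁸ = 1, h² = g⁴, gh = hg³⟩`. -/
def rels168 : Set (FreeGroup (Fin 2)) :=
  {fg ^ 8, fh ^ 2 * (fg ^ 4)⁻¹, fg * fh * (fh * fg ^ 3)⁻¹}

/-- The relators of `⟨g, h ∣ g⁸ = 1, h² = g⁴, gh = hg⁻¹⟩`. -/
def rels169 : Set (FreeGroup (Fin 2)) :=
  {fg ^ 8, fh ^ 2 * (fg ^ 4)⁻¹, fg * fh * (fh * fg⁻¹)⁻¹}

/-- `G_{[16,8]} = ⟨g, h ∣ g⁸ = 1, h² = g⁴, gh = hg³⟩`. -/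
abbrev G168 : Type := PresentedGroup rels168

/-- `G_{[16,9]} = ⟨g, h ∣ g⁸ = 1, h² = g⁴, gh = hg⁻¹⟩`. -/
abbrev G169 : Type := PresentedGroup rels169

/-- The generator `g` of a group presented on two generators. -/
def genG {rels : Set (FreeGroup (Fin 2))} : PresentedGroup rels := PresentedGroup.of 0

/-- The generator `h` of a group presented on two generators. -/
def genH {rels : Set (FreeGroup (Fin 2))} : PresentedGroup rels := PresentedGroup.of 1

end OrientedGroupRing

end

universe u v

/-! Necessity. Compare the coefficient of `x * y` in the two products of antisymmetric elements `x ±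
x⁻¹` and `y ± y⁻¹`, the sign being minus inside `N` and plus outside. As `2 ≠ 0`, noncommuting `x`
and `y` must satisfy one of a few explicit relations. These make an element of order eight in `N`
central, and then `N` is central and `G` abelian; hence `N` has exponent dividing four
(`pow_four_eq_one`). So some `g` of order eight lies outside `N`. By conjugation, an element of `N`
not commuting with `g` inverts `g` if it has order four (`commute_or_semiconjBy_inv`), and sends `g`
to `g ^ 3` if it is an involution (`semiconjBy_pow_three`). Using `g * x` and `g ^ 3 * x` as further
elements of order eight, the centralizer `C` of `g` in `N` is abelian, so some `h ∈ N` does not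
commute with `g`. If `h` can be taken of order four, the relations inside `N` give quaternion
subgroups and `4 = 0`; otherwise `h` is an involution, and comparing `r h` with `g + g⁻¹` forces `R₂
= 0`. In both cases `G = ⟨g, h⟩ × E`, where `E` is a complement of `⟨g ^ 4⟩` among the elements of
`C` squaring to `1` (`isModelProduct_of_generators`).

Sufficiency. Put `z = g ^ 4`, a central involution. The antisymmetric elements are spanned by the `x
(1 - z)`, the `x (1 + z)`, the `x + x⁻¹` and torsion multiples of elements of `N` squaring to `1`.
Since `(1 - z)(1 + z) = 0` and `z (1 + z) = 1 + z`, commutation up to `z` is often enough; a pair of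
elements with factor `1 - z` needs genuine commutation or `4 = 0`. What remains is a finite check in
a group of order 16. -/

namespace OrientedGroupRing

/-! ### Relations forced by comparing coefficients. -/

section Necessity

variable {R : Type*} [CommRing R] {G : Type*} [Group G] {σ : G →* ℤˣ}

open MonoidAlgebra (single)

theorem sub_phi_mem_antisymmetric (x : G) :
    single x (1 : R) - single x⁻¹ (((σ x : ℤˣ) : ℤ) : R) ∈ antisymmetric R σ := by
  have h : (((σ x : ℤˣ) : ℤ) : R) * (((σ x : ℤˣ) : ℤ) : R) = 1 := by
    rcases Int.units_eq_one_or (σ x) with h | h <;> simp [h]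
  simp [antisymmetric, phi_single, h]

theorem sub_inv_mem_antisymmetric {x : G} (hx : σ x = 1) :
    single x (1 : R) - single x⁻¹ 1 ∈ antisymmetric R σ := by
  simpa [hx] using sub_phi_mem_antisymmetric (R := R) (σ := σ) x

theorem add_inv_mem_antisymmetric {x : G} (hx : σ x = -1) :
    single x (1 : R) + single x⁻¹ 1 ∈ antisymmetric R σ := by
  simpa [hx, MonoidAlgebra.single_neg] using sub_phi_mem_antisymmetric (R := R) (σ := σ) x

theorem inv_eq_self_of_sq {x : G} (hx : x ^ 2 = 1) : x⁻¹ = x := by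
  rw [inv_eq_iff_mul_eq_one, ← sq, hx]

theorem single_mem_antisymmetric {x : G} (hx : σ x = -1) (h2 : x ^ 2 = 1) (r : R) :
    single x r ∈ antisymmetric R σ := by
  simp [antisymmetric, phi_single, hx, inv_eq_self_of_sq h2, MonoidAlgebra.single_neg]

theorem torsion_single_mem_antisymmetric {x : G} (hx : σ x = 1) (h2 : x ^ 2 = 1) {r : R}
    (hr : 2 * r = 0) : single x r ∈ antisymmetric R σ := by
  have : r = -r := by linear_combination hr
  simp [antisymmetric, phi_single, hx, inv_eq_self_of_sq h2, ← MonoidAlgebra.single_neg, ← this]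


/-- A nontrivial commutation relation between `x ∈ N` and `y ∉ N`. -/
theorem mixed_relation (H : AntisymmetricCommutative R σ) (h2 : (2 : R) ≠ 0) {x y : G}
    (hx : σ x = 1) (hy : σ y = -1) (hx2 : x ^ 2 ≠ 1) (hy2 : y ^ 2 ≠ 1) (hxy : x * y ≠ y * x) :
    x * y = x⁻¹ * y⁻¹ ∨ x * y = y⁻¹ * x := by
  classical
  have h := congrArg (fun t => t.coeff (x * y))
    (H _ (sub_inv_mem_antisymmetric hx) _ (add_inv_mem_antisymmetric hy))
  have : Nontrivial R := ⟨2, 0, h2⟩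
  have e1 : x⁻¹ * y ≠ x * y := fun e => hx2 (by
    rw [sq, mul_eq_one_iff_inv_eq]; exact mul_right_cancel e)
  have e2 : x * y⁻¹ ≠ x * y := fun e => hy2 (by
    rw [sq, mul_eq_one_iff_inv_eq]; exact mul_left_cancel e)
  by_contra! hc
  -- These two terms have equal signs; together they would only give `3 = 0`, which is no
  -- contradiction.
  have e3 : ¬ (y * x⁻¹ = x * y ∧ y⁻¹ * x⁻¹ = x * y) := fun ⟨e, e'⟩ => hy2 (by
    rw [sq, mul_eq_one_iff_inv_eq]; exact (mul_right_cancel (e.trans e'.symm)).symm)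
  simp only [mul_add, add_mul, sub_mul, mul_sub, MonoidAlgebra.single_mul_single,
    MonoidAlgebra.coeff_add, MonoidAlgebra.coeff_sub, MonoidAlgebra.coeff_single,
    Finsupp.add_apply, Finsupp.sub_apply, Finsupp.single_apply, hc.1.symm, hc.2.symm, e1, e2,
    hxy.symm, if_true, if_false, mul_one] at h
  by_cases f1 : y * x⁻¹ = x * y <;> by_cases f2 : y⁻¹ * x⁻¹ = x * y
  · exact e3 ⟨f1, f2⟩
  all_goals
    simp only [f1, f2, if_true, if_false] at h
    first
    | exact h2 (by linear_combination h)
    | exact one_ne_zero (α := R) (by linear_combination h)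

/-- A nontrivial commutation relation between two elements outside `N`. -/
theorem outside_relation (H : AntisymmetricCommutative R σ) (h2 : (2 : R) ≠ 0) {x y : G}
    (hx : σ x = -1) (hy : σ y = -1) (hx2 : x ^ 2 ≠ 1) (hy2 : y ^ 2 ≠ 1) (hxy : x * y ≠ y * x) :
    x * y = y * x⁻¹ ∨ x * y = y⁻¹ * x ∨ x * y = y⁻¹ * x⁻¹ := by
  classical
  have h := congrArg (fun t => t.coeff (x * y))
    (H _ (add_inv_mem_antisymmetric hx) _ (add_inv_mem_antisymmetric hy))
  have : Nontrivial R := ⟨2, 0, h2⟩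
  have e1 : x⁻¹ * y ≠ x * y := fun e => hx2 (by
    rw [sq, mul_eq_one_iff_inv_eq]; exact mul_right_cancel e)
  have e2 : x * y⁻¹ ≠ x * y := fun e => hy2 (by
    rw [sq, mul_eq_one_iff_inv_eq]; exact mul_left_cancel e)
  by_contra! hc
  simp only [mul_add, add_mul, MonoidAlgebra.single_mul_single,
    MonoidAlgebra.coeff_add, MonoidAlgebra.coeff_single,
    Finsupp.add_apply, Finsupp.single_apply, hc.1.symm, hc.2.1.symm, hc.2.2.symm, e1, e2,
    hxy.symm, if_true, if_false, mul_one] at h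
  by_cases f1 : x⁻¹ * y⁻¹ = x * y
  all_goals
    simp only [f1, if_true, if_false] at h
    first
    | exact h2 (by linear_combination h)
    | exact one_ne_zero (α := R) (by linear_combination h)

/-- Elements of order two outside `N` commute with the elements of `N` of larger order. -/
theorem commute_of_sq_eq_one (H : AntisymmetricCommutative R σ) (h2 : (2 : R) ≠ 0) {x y : G}
    (hx : σ x = 1) (hy : σ y = -1) (hx2 : x ^ 2 ≠ 1) (hy2 : y ^ 2 = 1) : x * y = y * x := by
  classical
  have h := congrArg (fun t => t.coeff (x * y))
    (H _ (sub_inv_mem_antisymmetric hx) _ (single_mem_antisymmetric hy hy2 1))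
  have : Nontrivial R := ⟨2, 0, h2⟩
  have e1 : x⁻¹ * y ≠ x * y := fun e => hx2 (by
    rw [sq, mul_eq_one_iff_inv_eq]; exact mul_right_cancel e)
  by_contra hc
  simp only [sub_mul, mul_sub, MonoidAlgebra.single_mul_single,
    MonoidAlgebra.coeff_sub, MonoidAlgebra.coeff_single,
    Finsupp.sub_apply, Finsupp.single_apply, e1, Ne.symm hc, if_true, if_false, mul_one] at h
  by_cases f1 : y * x⁻¹ = x * y
  all_goals
    simp only [f1, if_true, if_false] at h
    first
    | exact h2 (by linear_combination h)
    | exact one_ne_zero (α := R) (by linear_combination h)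

/-- If `y` inverts `x`, both lie in `N` and `(x * y) ^ 2 ≠ 1`, then `⟨x, y⟩` is a quaternion group
and `4 = 0` in `R`. -/
theorem four_eq_zero_of_inverts (H : AntisymmetricCommutative R σ) (h2 : (2 : R) ≠ 0) {x y : G}
    (hx : σ x = 1) (hy : σ y = 1) (hx2 : x ^ 2 ≠ 1) (hy2 : y ^ 2 ≠ 1)
    (hinv : x * y = y * x⁻¹) (hxy : (x * y) ^ 2 ≠ 1) :
    x * y = x⁻¹ * y⁻¹ ∧ (4 : R) = 0 := by
  classical
  have h := congrArg (fun t => t.coeff (x * y))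
    (H _ (sub_inv_mem_antisymmetric hx) _ (sub_inv_mem_antisymmetric hy))
  have : Nontrivial R := ⟨2, 0, h2⟩
  have e1 : x⁻¹ * y ≠ x * y := fun e => hx2 (by
    rw [sq, mul_eq_one_iff_inv_eq]; exact mul_right_cancel e)
  have e2 : x * y⁻¹ ≠ x * y := fun e => hy2 (by
    rw [sq, mul_eq_one_iff_inv_eq]; exact mul_left_cancel e)
  have e3 : y⁻¹ * x⁻¹ ≠ x * y := fun e => hxy (by
    rw [sq, mul_eq_one_iff_inv_eq, mul_inv_rev, e])
  have e4 : y * x ≠ x * y := fun e => hx2 (by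
    rw [sq, mul_eq_one_iff_inv_eq]; exact (mul_left_cancel (e.trans hinv)).symm)
  -- The two remaining terms are the same group element, so the coefficient equation reads `4 = 0`
  -- or `2 = 0`.
  have e5 : (x⁻¹ * y⁻¹ = x * y) ↔ (y⁻¹ * x = x * y) := by
    have : x⁻¹ * y⁻¹ = y⁻¹ * x := by
      rw [eq_comm, inv_mul_eq_iff_eq_mul, ← mul_assoc]
      exact eq_mul_inv_of_mul_eq hinv
    rw [this]
  simp only [sub_mul, mul_sub, MonoidAlgebra.single_mul_single,
    MonoidAlgebra.coeff_sub, MonoidAlgebra.coeff_single,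
    Finsupp.sub_apply, Finsupp.single_apply, e1, e2, e3, e4, e5, hinv.symm,
    if_true, if_false, mul_one] at h
  by_cases f1 : y⁻¹ * x = x * y
  · refine ⟨(e5.2 f1).symm, ?_⟩
    simp only [f1, if_true] at h
    linear_combination h
  · simp only [f1, if_false] at h
    exact absurd (by linear_combination h) h2

end Necessity

/-! ### The exponent of `N`, and how `N` acts on an element of order eight. -/

section GroupStructure

variable {R : Type*} [CommRing R] {G : Type*} [Group G] {σ : G →* ℤˣ}

theorem sigma_eq_neg_one {x : G} (hx : σ x ≠ 1) : σ x = -1 :=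
  (Int.units_eq_one_or _).resolve_left hx

theorem sq_eq_inv_sq_iff {g : G} : g ^ 2 = (g ^ 2)⁻¹ ↔ g ^ 4 = 1 := by
  rw [eq_comm, inv_eq_iff_mul_eq_one, ← pow_add]

theorem sq_eq_inv_sq_of_mul_eq {x y : G} (h : x * y = x⁻¹ * y⁻¹) : x ^ 2 = (y ^ 2)⁻¹ := by
  calc x ^ 2 = x * (x * y) * y⁻¹ := by simp [sq, mul_assoc]
    _ = (y ^ 2)⁻¹ := by rw [h]; group

/-- If `y` fails to commute with `g`, so does `y * g ^ 2`, and both obey the dichotomy `key`. Each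
of the four combinations yields `g ^ 2 = (g ^ 2)⁻¹`. -/
theorem commute_of_mem_of_not_mem (H : AntisymmetricCommutative R σ) (h2 : (2 : R) ≠ 0)
    (h8 : ∀ x : G, x ^ 8 = 1) {g y : G} (hg : σ g = 1) (hg4 : g ^ 4 ≠ 1) (hy : σ y = -1) :
    Commute g y := by
  have hg2 : g ^ 2 ≠ 1 := fun h => hg4 (by rw [show 4 = 2 * 2 from rfl, pow_mul, h, one_pow])
  have key : ∀ {y : G}, σ y = -1 → ¬ Commute g y → y ^ 2 = (g ^ 2)⁻¹ ∨ SemiconjBy g y y⁻¹ := by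
    intro y hy hc
    by_cases hy2 : y ^ 2 = 1
    · exact absurd (commute_of_sq_eq_one H h2 hg hy hg2 hy2) hc
    · refine (mixed_relation H h2 hg hy hg2 hy2 hc).imp (fun h => ?_) fun h => h
      rw [sq_eq_inv_sq_of_mul_eq h, inv_inv]
  by_contra hc
  have hc' : ¬ Commute g (y * g ^ 2) := fun h => hc (by
    have := h.mul_right ((Commute.refl g).pow_right 2).inv_right
    rwa [mul_inv_cancel_right] at this)
  have hy' : σ (y * g ^ 2) = -1 := by simp [hy, hg]
  have semi : ∀ {y : G}, y ^ 2 = g ^ 2 → ¬ SemiconjBy g y y⁻¹ := by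
    intro y h1 h
    have := h.pow_right 2
    rw [inv_pow, h1] at this
    have h3 : SemiconjBy g (g ^ 2) (g ^ 2) := (Commute.refl g).pow_right 2
    exact hg4 (sq_eq_inv_sq_iff.1 (mul_right_cancel (h3.symm.trans this)))
  have sq_mul : Commute y (g ^ 2) → (y * g ^ 2) ^ 2 = y ^ 2 * g ^ 4 := fun h => by
    rw [h.mul_pow, ← pow_mul]
  rcases key hy hc with h | h
  · have hyg : Commute y (g ^ 2) := by
      rw [← inv_inv (g ^ 2), ← h]
      exact ((Commute.refl y).pow_right 2).inv_right
    have h' : (y * g ^ 2) ^ 2 = g ^ 2 := by rw [sq_mul hyg, h]; group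
    rcases key hy' hc' with h1 | h1
    · exact hg4 (sq_eq_inv_sq_iff.1 (h'.symm.trans h1))
    · exact semi h' h1
  · have hyg : Commute y (g ^ 2) := by
      have := h.inv_right.mul_left h
      rw [inv_inv, ← sq] at this
      exact this.symm
    rcases key hy' hc' with h1 | h1
    · refine semi ?_ h
      rw [sq_mul hyg] at h1
      calc y ^ 2 = (y ^ 2 * g ^ 4) * g ^ 2 * (g ^ 8)⁻¹ * g ^ 2:= by group
        _ = g ^ 2 := by rw [h1, h8]; group
    · have h3 : SemiconjBy g (y * g ^ 2) (y⁻¹ * g ^ 2) :=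
        h.mul_right ((Commute.refl g).pow_right 2)
      have h4 := mul_right_cancel (h3.symm.trans h1)
      rw [hyg.eq, mul_inv_rev, mul_left_cancel_iff] at h4
      exact hg4 (sq_eq_inv_sq_iff.1 h4)

theorem commute_of_forall_commute_outside {g : G} {τ : G} (hτ : σ τ = -1)
    (h : ∀ y, σ y = -1 → Commute g y) (y : G) : Commute g y := by
  by_cases hy : σ y = 1
  · have := (h (y * τ) (by simp [hy, hτ])).mul_right (h τ hτ).inv_right
    rwa [mul_inv_cancel_right] at this
  · exact h y (sigma_eq_neg_one hy)

/-- If all the elements of the subgroup `ker σ` of index two are central, `G` is abelian. -/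
theorem commute_of_ker_central (h : ∀ x, σ x = 1 → ∀ y, Commute x y) (x y : G) : Commute x y := by
  by_cases hx : σ x = 1
  · exact h x hx y
  by_cases hy : σ y = 1
  · exact (h y hy x).symm
  have := (h (x * y) (by simp [sigma_eq_neg_one hx, sigma_eq_neg_one hy]) x).symm
  have := (Commute.refl x).inv_right.mul_right this
  rwa [inv_mul_cancel_left] at this

theorem pow_four_eq_one (H : AntisymmetricCommutative R σ) (h2 : (2 : R) ≠ 0)
    (h8 : ∀ x : G, x ^ 8 = 1) (hG : ∃ x y : G, x * y ≠ y * x) {τ : G} (hτ : σ τ = -1)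
    {g : G} (hg : σ g = 1) : g ^ 4 = 1 := by
  by_contra hg4
  have central : ∀ {x : G}, σ x = 1 → x ^ 4 ≠ 1 → ∀ y, Commute x y := fun hx hx4 =>
    commute_of_forall_commute_outside hτ fun y hy => commute_of_mem_of_not_mem H h2 h8 hx hx4 hy
  obtain ⟨x, y, hxy⟩ := hG
  refine hxy (commute_of_ker_central (σ := σ) (fun x hx y => ?_) x y)
  by_cases hx4 : x ^ 4 = 1
  · have h : (g * x) ^ 4 ≠ 1 := by rwa [(central hg hg4 x).mul_pow, hx4, mul_one]
    have := (central hg hg4 y).inv_left.mul_left (central (x := g * x) (by simp [hg, hx]) h y)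
    rwa [inv_mul_cancel_left] at this
  · exact central hx hx4 y

theorem pow_two_ne_one {g : G} (hg4 : g ^ 4 ≠ 1) : g ^ 2 ≠ 1 := fun h =>
  hg4 (by rw [show 4 = 2 * 2 from rfl, pow_mul, h, one_pow])

/-- An element of `N` of order larger than two centralizes or inverts every element of order
eight outside `N`. -/
theorem commute_or_semiconjBy_inv (H : AntisymmetricCommutative R σ) (h2 : (2 : R) ≠ 0)
    (h4 : ∀ x : G, σ x = 1 → x ^ 4 = 1) {x g : G} (hx : σ x = 1) (hx2 : x ^ 2 ≠ 1)
    (hg : σ g = -1) (hg4 : g ^ 4 ≠ 1) : Commute x g ∨ SemiconjBy x g g⁻¹ := by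
  by_contra! hc
  rcases mixed_relation H h2 hx hg hx2 (pow_two_ne_one hg4) hc.1 with h | h
  · have h' := sq_eq_inv_sq_of_mul_eq h
    apply hg4
    rw [show 4 = 2 * 2 from rfl, pow_mul, ← inv_inj, ← inv_pow, ← h', ← pow_mul, inv_one]
    exact h4 x hx
  · exact hc.2 h

/-- The relation for `u * g` and `g` shows that `u` inverts `g ^ 2`; the one for `g ^ 2` and `g * u`
then gives `(g * u) ^ 2 = g ^ 4`, which is the claim after cancelling `g`. -/
theorem semiconjBy_pow_three (H : AntisymmetricCommutative R σ) (h2 : (2 : R) ≠ 0)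
    {u g : G} (hu : σ u = 1) (hu2 : u ^ 2 = 1)
    (hg : σ g = -1) (hg4 : g ^ 4 ≠ 1) (hg8 : g ^ 8 = 1) (hc : ¬ Commute u g) :
    SemiconjBy u g (g ^ 3) := by
  have hinv : u⁻¹ = u := inv_eq_self_of_sq hu2
  have huu : u * u = 1 := by rw [← sq, hu2]
  have hg22 : (g ^ 2) ^ 2 ≠ 1 := by rwa [← pow_mul]
  have not_both : SemiconjBy u (g ^ 2) (g ^ 2)⁻¹ → ¬ Commute u (g ^ 2) := fun h h' =>
    hg4 (sq_eq_inv_sq_iff.1 (mul_right_cancel (h'.symm.trans h)))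
  have semi_of_sq : (u * g) ^ 2 = 1 → SemiconjBy u g g⁻¹ := fun h => by
    have := inv_eq_self_of_sq h
    rw [mul_inv_rev, hinv] at this
    exact this.symm
  -- Otherwise `u` would invert `g`, while the involution `u * g` outside `N` would commute with `g
  -- ^ 2`.
  have hug : (u * g) ^ 2 ≠ 1 := fun h => by
    have hcomm := commute_of_sq_eq_one H h2 (x := g ^ 2) (y := u * g) (by simp [hg])
      (by simp [hg, hu]) hg22 h
    have hcomm : Commute (g ^ 2) u := by
      have := Commute.mul_right hcomm (((Commute.refl g).pow_left 2).inv_right)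
      rwa [mul_inv_cancel_right] at this
    have := (semi_of_sq h).pow_right 2
    rw [inv_pow] at this
    exact not_both this hcomm.symm
  have hgu : (g * u) ^ 2 ≠ 1 := fun h => hug (by
    rw [sq, mul_eq_one_iff_inv_eq, mul_inv_rev, hinv]
    have := inv_eq_self_of_sq h
    rw [mul_inv_rev, hinv] at this
    simpa using (SemiconjBy.inv_right (a := u) this).eq.symm)
  have semi : SemiconjBy u (g ^ 2) (g ^ 2)⁻¹ := by
    rcases outside_relation H h2 (x := u * g) (y := g) (by simp [hu, hg]) hg hug
      (pow_two_ne_one hg4) 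
      (fun h => hc (mul_right_cancel (h.trans (mul_assoc g u g).symm))) with h | h | h
    · refine absurd ?_ (pow_two_ne_one hg4)
      rw [mul_inv_rev, hinv, mul_inv_cancel_left, mul_assoc] at h
      rw [sq]; exact mul_eq_left.1 h
    · rw [← mul_assoc g⁻¹] at h
      have := mul_right_cancel h
      refine absurd ?_ hug
      rw [sq, mul_eq_one_iff_inv_eq, mul_inv_rev, hinv, this]
    · rw [mul_inv_rev, hinv, mul_assoc, ← sq, ← mul_assoc, ← mul_inv_rev, ← sq] at h
      exact h
  have hv2 : (g * u) * (g * u) = g ^ 4 := by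
    have hne : g ^ 2 * (g * u) ≠ g * u * g ^ 2 := fun h => not_both semi (by
      have := ((Commute.refl g).pow_left 2).inv_right.mul_right h
      rw [inv_mul_cancel_left] at this
      exact this.symm)
    rcases mixed_relation H h2 (x := g ^ 2) (y := g * u) (by simp [hg]) (by simp [hg, hu]) hg22 hgu
      hne with h | h
    · rw [← sq, ← inv_inj, ← sq_eq_inv_sq_of_mul_eq h, ← pow_mul, eq_inv_iff_mul_eq_one, ← pow_add,
        hg8]
    · calc g * u * (g * u) = g * u * (g ^ 2)⁻¹ * (g ^ 2 * (g * u)) := by group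
        _ = g * (u * (g ^ 2)⁻¹) * (g * u)⁻¹ * g ^ 2 := by rw [h]; group
        _ = g ^ 4 := by rw [semi.inv_right.eq, inv_inv]; group
  have : u * g = g ^ 3 * u⁻¹ := by
    rw [eq_mul_inv_iff_mul_eq]
    apply mul_left_cancel (a := g)
    rw [← pow_succ', ← hv2]
    simp only [mul_assoc]
  rwa [hinv] at this

end GroupStructure

/-! ### Concrete models of the two groups of order 16. -/

section Model

/-- The two groups of order 16 occurring in the classification. -/
inductive Kind
  | semidihedral
  | quaternion

namespace Kind

/-- The exponent `m` with `u g u⁻¹ = g ^ m`. -/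
def twist : Kind → ZMod 8
  | semidihedral => 3
  | quaternion => -1

/-- The exponent `c` with `u ^ 2 = g ^ c`. -/
def square : Kind → ZMod 8
  | semidihedral => 0
  | quaternion => 4

theorem twist_mul_twist (κ : Kind) : κ.twist * κ.twist = 1 := by cases κ <;> decide

theorem twist_mul_square (κ : Kind) : κ.twist * κ.square = κ.square := by cases κ <;> decide

end Kind

/-- The group `⟨g, u ∣ g ^ 8 = 1, u ^ 2 = g ^ c, u g u⁻¹ = g ^ m⟩`, with `⟨i, b⟩` standing for
`g ^ i * u ^ b`. -/
@[ext]
structure Model (κ : Kind) where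
  /-- The exponent of `g`. -/
  rot : ZMod 8
  /-- Whether `u` occurs. -/
  refl : Bool
  deriving DecidableEq, Fintype

namespace Model

variable {κ : Kind}

/-- The action of `u ^ b` on exponents of `g`. -/
def act (κ : Kind) (b : Bool) (k : ZMod 8) : ZMod 8 := bif b then κ.twist * k else k

/-- The exponent of `g` carried over in the product of `u ^ a` and `u ^ b`. -/
def carry (κ : Kind) (a b : Bool) : ZMod 8 := bif a && b then κ.square else 0

instance : Mul (Model κ) := ⟨fun p q => ⟨p.1 + act κ p.2 q.1 + carry κ p.2 q.2, xor p.2 q.2⟩⟩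

instance : One (Model κ) := ⟨⟨0, false⟩⟩

-- With `m` and `c` the twist and the square, `(g ^ i * u)⁻¹ = g ^ (-c - m * i) * u`, and `m * c =
-- c`.
instance : Inv (Model κ) := ⟨fun p => ⟨bif p.2 then -κ.twist * (p.1 + κ.square) else -p.1, p.2⟩⟩

theorem mk_mul_mk (i j : ZMod 8) (a b : Bool) :
    (⟨i, a⟩ * ⟨j, b⟩ : Model κ) = ⟨i + act κ a j + carry κ a b, xor a b⟩ := rfl

theorem one_def : (1 : Model κ) = ⟨0, false⟩ := rfl

theorem inv_mk (i : ZMod 8) (a : Bool) :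
    (⟨i, a⟩⁻¹ : Model κ) = ⟨bif a then -κ.twist * (i + κ.square) else -i, a⟩ := rfl

-- The axioms come down to `m * m = 1` and `m * c = c` in `ZMod 8`.
instance : Group (Model κ) :=
  Group.ofLeftAxioms
    (fun ⟨i, a⟩ ⟨j, b⟩ ⟨k, c⟩ => by
      have h1 := κ.twist_mul_twist
      have h2 := κ.twist_mul_square
      refine Model.ext ?_ (Bool.xor_assoc a b c)
      cases a <;> cases b <;> cases c <;>
        simp only [mk_mul_mk, act, carry, cond_true, cond_false, Bool.and_true, Bool.and_false,
          Bool.xor_true, Bool.not_true, Bool.not_false, Bool.xor_false] <;>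
        first | ring1 | linear_combination -h2 | linear_combination -k * h1 |
          linear_combination -k * h1 - h2)
    (fun ⟨i, a⟩ => by simp [mk_mul_mk, one_def, act, carry])
    (fun ⟨i, a⟩ => by
      have h2 := κ.twist_mul_square
      cases a <;> simp only [mk_mul_mk, one_def, inv_mk, act, carry, cond_true, cond_false,
        Bool.xor_self, Bool.and_true, Bool.and_false, Model.mk.injEq, and_true]
      · ring1
      · linear_combination -h2)

/-- The generator of order eight. -/
def g : Model κ := ⟨1, false⟩

/-- The second generator. -/
def u : Model κ := ⟨0, true⟩

section Hom

variable {H : Type*} [Group H] {a b : H}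

theorem pow_val_add (ha : a ^ 8 = 1) (i j : ZMod 8) :
    a ^ (i + j).val = a ^ i.val * a ^ j.val := by
  rw [ZMod.val_add, ← pow_eq_pow_mod _ ha, pow_add]

theorem pow_val_mul (ha : a ^ 8 = 1) (i j : ZMod 8) :
    a ^ (i * j).val = (a ^ i.val) ^ j.val := by
  rw [ZMod.val_mul, ← pow_eq_pow_mod _ ha, pow_mul]

/-- The homomorphism out of the model given by a pair satisfying its defining relations. -/
def hom (κ : Kind) (ha : a ^ 8 = 1) (hb : b * b = a ^ κ.square.val)
    (hab : SemiconjBy b a (a ^ κ.twist.val)) : Model κ →* H where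
  toFun p := a ^ p.rot.val * bif p.refl then b else 1
  map_one' := by simp [one_def]
  map_mul' := by
    rintro ⟨i, r⟩ ⟨j, s⟩
    have h := (hab.pow_right j.val).eq
    cases r <;> cases s <;>
      simp only [mk_mul_mk, act, carry, cond_true, cond_false, Bool.and_true, Bool.and_false,
        Bool.xor_true, Bool.xor_false, Bool.not_true, Bool.not_false, pow_val_add ha,
        pow_val_mul ha, ← hb, ZMod.val_zero, pow_zero, mul_one]
    · simp only [mul_assoc]
    · simp only [mul_assoc, h]
    · simp only [mul_assoc]
      rw [← mul_assoc b _ b, h, mul_assoc]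

theorem hom_apply (ha : a ^ 8 = 1) (hb : b * b = a ^ κ.square.val)
    (hab : SemiconjBy b a (a ^ κ.twist.val)) (p : Model κ) :
    hom κ ha hb hab p = a ^ p.rot.val * bif p.refl then b else 1 := rfl

theorem hom_g (ha : a ^ 8 = 1) (hb : b * b = a ^ κ.square.val)
    (hab : SemiconjBy b a (a ^ κ.twist.val)) : hom κ ha hb hab g = a := by
  simp [hom_apply, g, show (1 : ZMod 8).val = 1 from rfl]

theorem hom_u (ha : a ^ 8 = 1) (hb : b * b = a ^ κ.square.val)
    (hab : SemiconjBy b a (a ^ κ.twist.val)) : hom κ ha hb hab u = b := by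
  simp [hom_apply, u]

theorem g_pow (n : ℕ) : (g : Model κ) ^ n = ⟨n, false⟩ := by
  induction n with
  | zero => simp [one_def]
  | succ n ih => rw [pow_succ, ih]; simp [g, mk_mul_mk, act, carry]

theorem eq_g_pow_mul (p : Model κ) : p = g ^ p.rot.val * bif p.refl then u else 1 := by
  rcases p with ⟨i, r⟩
  cases r <;> simp [g_pow, u, mk_mul_mk, act, carry]

theorem hom_ext {f f' : Model κ →* H} (hg : f g = f' g) (hu : f u = f' u) : f = f' := by
  ext p
  rw [eq_g_pow_mul p]
  cases p.refl <;> simp [hg, hu]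

end Hom

/-- The orientation of the model: `g ↦ -1`, `u ↦ 1`. -/
def orient (κ : Kind) : Model κ →* ℤˣ :=
  hom κ (a := -1) (b := 1) rfl (by cases κ <;> rfl) (by cases κ <;> rfl)

theorem orient_g : orient κ g = -1 := hom_g _ _ _

theorem orient_u : orient κ u = 1 := hom_u _ _ _

theorem even_of_orient_eq_one {p : Model κ} (hp : orient κ p = 1) : Even p.rot.val := by
  by_contra h
  have : orient κ p = (-1) ^ p.rot.val * bif p.refl then 1 else 1 := rfl
  rw [this, (Nat.not_even_iff_odd.1 h).neg_one_pow, Bool.cond_self] at hp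
  exact absurd hp (by decide)

/-! ### The presented groups are the models. -/

section Presented

theorem genG_pow_eight_168 : (genG : G168) ^ 8 = 1 := by
  have := PresentedGroup.one_of_mem (rels := rels168) (x := fg ^ 8) (by simp [rels168])
  rwa [map_pow] at this

theorem genH_sq_168 : (genH : G168) ^ 2 = genG ^ 4 := by
  have := PresentedGroup.one_of_mem (rels := rels168) (x := fh ^ 2 * (fg ^ 4)⁻¹) (by simp [rels168])
  rwa [map_mul, map_inv, map_pow, map_pow, mul_inv_eq_one] at this

theorem genG_mul_genH_168 : (genG : G168) * genH = genH * genG ^ 3 := by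
  have := PresentedGroup.one_of_mem (rels := rels168) (x := fg * fh * (fh * fg ^ 3)⁻¹)
    (by simp [rels168])
  rwa [map_mul, map_inv, map_mul, map_mul, map_pow, mul_inv_eq_one] at this

theorem genG_pow_eight_169 : (genG : G169) ^ 8 = 1 := by
  have := PresentedGroup.one_of_mem (rels := rels169) (x := fg ^ 8) (by simp [rels169])
  rwa [map_pow] at this

theorem genH_sq_169 : (genH : G169) ^ 2 = genG ^ 4 := by
  have := PresentedGroup.one_of_mem (rels := rels169) (x := fh ^ 2 * (fg ^ 4)⁻¹) (by simp [rels169])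
  rwa [map_mul, map_inv, map_pow, map_pow, mul_inv_eq_one] at this

theorem genG_mul_genH_169 : (genG : G169) * genH = genH * genG⁻¹ := by
  have := PresentedGroup.one_of_mem (rels := rels169) (x := fg * fh * (fh * fg⁻¹)⁻¹)
    (by simp [rels169])
  rwa [map_mul, map_inv, map_mul, map_mul, map_inv, mul_inv_eq_one] at this

/-- The homomorphism from the semidihedral model with `u ↦ g * h`. -/
def toG168 : Model .semidihedral →* G168 :=
  hom .semidihedral (a := genG) (b := genG * genH) genG_pow_eight_168
    (by
      calc (genG * genH * (genG * genH) : G168) = genG * genH * (genH * genG ^ 3) := by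
            rw [← genG_mul_genH_168]
        _ = genG * genH ^ 2 * genG ^ 3 := by simp only [sq, mul_assoc]
        _ = genG ^ 8 := by rw [genH_sq_168, ← pow_succ', ← pow_add]
        _ = 1 := genG_pow_eight_168)
    (by
      have h : SemiconjBy (genH : G168) (genG ^ 3) genG := genG_mul_genH_168.symm
      -- The relation says that `h` takes `g ^ 3` to `g`; as `3 * 3 = 1` modulo `8`, cubing shows
      -- that it takes `g` to `g ^ 3`.
      have h := h.pow_right 3
      rw [← pow_mul, show 3 * 3 = 8 + 1 from rfl, pow_succ, genG_pow_eight_168, one_mul] at h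
      exact (((Commute.refl genG).pow_right 3).semiconjBy).mul_left h)

theorem toG168_g : toG168 g = genG := hom_g _ _ _

theorem toG168_u : toG168 u = genG * genH := hom_u _ _ _

/-- `⟨g, h ∣ g⁸ = 1, h² = g⁴, gh = hg³⟩` is the semidihedral model, with `g * h = u`. -/
def equivG168 : G168 ≃* Model .semidihedral :=
  MonoidHom.toMulEquiv
    (PresentedGroup.toGroup (f := ![g, g⁻¹ * u]) (by
      rintro r (rfl | rfl | rfl) <;> simp [fg, fh] <;> decide +kernel))
    toG168
    (by
      ext i
      fin_cases i
      · simp [toG168_g, genG]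
      · simp [toG168_g, toG168_u, genH])
    (hom_ext (by simp [toG168_g, genG]) (by simp [toG168_u, genG, genH]))

theorem equivG168_genG : equivG168 genG = g := by
  rw [← toG168_g]; exact equivG168.apply_symm_apply g

theorem equivG168_genG_mul_genH : equivG168 (genG * genH) = u := by
  rw [← toG168_u]; exact equivG168.apply_symm_apply u

/-- The homomorphism from the quaternion model with `u ↦ h`. -/
def toG169 : Model .quaternion →* G169 :=
  hom .quaternion (a := genG) (b := genH) genG_pow_eight_169
    (by rw [← sq]; exact genH_sq_169)
    (by
      have h : SemiconjBy (genH : G169) genG⁻¹ genG := genG_mul_genH_169.symm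
      have h := h.inv_right
      rwa [inv_inv, inv_eq_of_mul_eq_one_right (b := genG ^ 7)
        (by rw [← pow_succ', genG_pow_eight_169])] at h)

theorem toG169_g : toG169 g = genG := hom_g _ _ _

theorem toG169_u : toG169 u = genH := hom_u _ _ _

/-- `⟨g, h ∣ g⁸ = 1, h² = g⁴, gh = hg⁻¹⟩` is the quaternion model, with `h = u`. -/
def equivG169 : G169 ≃* Model .quaternion :=
  MonoidHom.toMulEquiv
    (PresentedGroup.toGroup (f := ![g, u]) (by
      rintro r (rfl | rfl | rfl) <;> simp [fg, fh] <;> decide +kernel))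
    toG169
    (by
      ext i
      fin_cases i
      · simp [toG169_g, genG]
      · simp [toG169_u, genH])
    (hom_ext (by simp [toG169_g, genG]) (by simp [toG169_u, genH]))

theorem equivG169_genG : equivG169 genG = g := by
  rw [← toG169_g]; exact equivG169.apply_symm_apply g

theorem equivG169_genH : equivG169 genH = u := by
  rw [← toG169_u]; exact equivG169.apply_symm_apply u

/-- The automorphism `g ↦ g`, `u ↦ g⁻¹ * u` of the quaternion model. -/
def quaternionTwist : Model .quaternion ≃* Model .quaternion :=
  MonoidHom.toMulEquiv
    (hom .quaternion (a := g) (b := g⁻¹ * u) (by decide +kernel) (by decide +kernel)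
      (by unfold SemiconjBy; decide +kernel))
    (hom .quaternion (a := g) (b := g * u) (by decide +kernel) (by decide +kernel)
      (by unfold SemiconjBy; decide +kernel))
    (by ext p <;> revert p <;> decide +kernel)
    (by ext p <;> revert p <;> decide +kernel)

theorem quaternionTwist_g : quaternionTwist g = g := by decide +kernel

theorem quaternionTwist_g_mul_u : quaternionTwist (g * u) = u := by decide +kernel

end Presented

end Model

/-- For an isomorphism onto `P × E`, where `P` is a copy of the model, the kernel of `σ` is
`⟨a², b⟩ × E` exactly if `σ` is the orientation of the model. -/
theorem ker_map_eq_prod_iff {κ : Kind} {G P E : Type*} [Group G] [Group P] [CommGroup E]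
    {σ : G →* ℤˣ} (hσ : σ ≠ 1) (θ : P ≃* Model κ) {a b : P} (ha : θ a = Model.g)
    (hb : θ b = Model.u) (e : G ≃* P × E) :
    σ.ker.map e.toMonoidHom = (Subgroup.closure {a ^ 2, b}).prod ⊤ ↔
      ∀ x, σ x = Model.orient κ (θ (e x).1) := by
  have hle : Subgroup.closure {a ^ 2, b} ≤ ((Model.orient κ).comp θ.toMonoidHom).ker := by
    rw [Subgroup.closure_le]
    rintro x (rfl | rfl)
    · change Model.orient κ (θ (a ^ 2)) = 1
      rw [map_pow, ha, map_pow, Model.orient_g]; rfl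
    · change Model.orient κ (θ x) = 1
      rw [hb, Model.orient_u]
  have hge : ∀ p, Model.orient κ (θ p) = 1 → p ∈ Subgroup.closure {a ^ 2, b} := by
    intro p hp
    obtain ⟨k, hk⟩ := Model.even_of_orient_eq_one hp
    have : p = (a ^ 2) ^ k * bif (θ p).refl then b else 1 := by
      apply θ.injective
      conv_lhs => rw [Model.eq_g_pow_mul (θ p)]
      rw [hk]
      cases (θ p).refl <;> simp [ha, hb, ← pow_mul, two_mul]
    rw [this]
    refine mul_mem (pow_mem (Subgroup.subset_closure (by simp)) k) ?_
    cases (θ p).refl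
    · exact one_mem _
    · exact Subgroup.subset_closure (by simp)
  constructor
  · intro h
    have hone : ∀ p ∈ Subgroup.closure {a ^ 2, b}, ∀ ε, σ (e.symm (p, ε)) = 1 := by
      intro p hp ε
      have : (p, ε) ∈ σ.ker.map e.toMonoidHom := by rw [h]; exact ⟨hp, trivial⟩
      obtain ⟨x, hx, hxe⟩ := this
      rw [← hxe]
      simpa using hx
    let f : Model κ →* ℤˣ := σ.comp (e.symm.toMonoidHom.comp
      ((MonoidHom.inl P E).comp θ.symm.toMonoidHom))
    -- `σ` is trivial on the factor `E`, so it factors through the model.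
    have hf : ∀ x, σ x = f (θ (e x).1) := by
      intro x
      have hx : x = e.symm ((e x).1, 1) * e.symm (1, (e x).2) := by
        rw [← map_mul]; simp
      conv_lhs => rw [hx, map_mul, hone 1 (one_mem _), mul_one]
      simp [f]
    have hfu : f Model.u = 1 := by
      have := hone b (Subgroup.subset_closure (by simp)) 1
      simpa [f, ← hb] using this
    -- The kernel contains `g ^ 2` and `u`, so only `g` can carry the nontriviality of `σ`.
    have hfg : f Model.g = -1 := by
      refine (Int.units_eq_one_or _).resolve_left fun hfg => hσ ?_
      have : f = 1 := Model.hom_ext hfg hfu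
      ext x
      rw [hf, this]; rfl
    have : f = Model.orient κ :=
      Model.hom_ext (hfg.trans Model.orient_g.symm) (hfu.trans Model.orient_u.symm)
    rwa [this] at hf
  · intro h
    ext ⟨p, ε⟩
    rw [Subgroup.mem_map_equiv, MonoidHom.mem_ker, h, e.apply_symm_apply, Subgroup.mem_prod]
    exact ⟨fun hp => ⟨hge p hp, trivial⟩, fun hp => hle hp.1⟩

/-- An isomorphism onto the product of a model and an elementary abelian group, respecting
orientations. -/
def IsModelProduct {G : Type v} [Group G] (σ : G →* ℤˣ) (κ : Kind) : Prop :=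
  ∃ (E : Type v) (_ : CommGroup E) (e : G ≃* Model κ × E),
    IsElementaryAbelianTwo E ∧ ∀ x, σ x = Model.orient κ (e x).1

theorem isModelProduct_iff {κ : Kind} {G : Type v} {P : Type*} [Group G] [Group P]
    {σ : G →* ℤˣ} (hσ : σ ≠ 1) (θ : P ≃* Model κ) {a b : P} (ha : θ a = Model.g)
    (hb : θ b = Model.u) :
    IsModelProduct σ κ ↔ ∃ (E : Type v) (_ : CommGroup E) (e : G ≃* P × E),
      IsElementaryAbelianTwo E ∧
        σ.ker.map e.toMonoidHom = (Subgroup.closure {a ^ 2, b}).prod ⊤ := by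
  constructor
  · rintro ⟨E, _, e, hE, h⟩
    refine ⟨E, _, e.trans (θ.symm.prodCongr (MulEquiv.refl E)), hE, ?_⟩
    rw [ker_map_eq_prod_iff hσ θ ha hb]
    intro x
    change σ x = Model.orient κ (θ (θ.symm (e x).1))
    rw [h, θ.apply_symm_apply]
  · rintro ⟨E, _, e, hE, h⟩
    rw [ker_map_eq_prod_iff hσ θ ha hb] at h
    refine ⟨E, _, e.trans (θ.prodCongr (MulEquiv.refl E)), hE, h⟩

theorem isModelProduct_semidihedral_iff {G : Type v} [Group G] {σ : G →* ℤˣ} (hσ : σ ≠ 1) :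
    IsModelProduct σ .semidihedral ↔ ∃ (E : Type v) (_ : CommGroup E) (e : G ≃* G168 × E),
      IsElementaryAbelianTwo E ∧
        σ.ker.map e.toMonoidHom = (Subgroup.closure {genG ^ 2, genG * genH}).prod ⊤ :=
  isModelProduct_iff hσ Model.equivG168 Model.equivG168_genG Model.equivG168_genG_mul_genH

theorem isModelProduct_quaternion_iff {G : Type v} [Group G] {σ : G →* ℤˣ} (hσ : σ ≠ 1) :
    IsModelProduct σ .quaternion ↔ ∃ (E : Type v) (_ : CommGroup E) (e : G ≃* G169 × E),
      IsElementaryAbelianTwo E ∧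
        (σ.ker.map e.toMonoidHom = (Subgroup.closure {genG ^ 2, genH}).prod ⊤ ∨
          σ.ker.map e.toMonoidHom = (Subgroup.closure {genG ^ 2, genG * genH}).prod ⊤) := by
  have h1 := isModelProduct_iff hσ Model.equivG169 Model.equivG169_genG Model.equivG169_genH
  -- The automorphism carries `g * h` to `u`, so the two possible kernels describe the same oriented
  -- group.
  have h2 := isModelProduct_iff hσ (Model.equivG169.trans Model.quaternionTwist)
    (a := genG) (b := genG * genH)
    (by simp [Model.equivG169_genG, Model.quaternionTwist_g])
    (by rw [MulEquiv.trans_apply, map_mul, Model.equivG169_genG, Model.equivG169_genH,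
      Model.quaternionTwist_g_mul_u])
  constructor
  · intro h
    obtain ⟨E, i, e, hE, h⟩ := h1.1 h
    exact ⟨E, i, e, hE, .inl h⟩
  · rintro ⟨E, i, e, hE, h | h⟩
    · exact h1.2 ⟨E, i, e, hE, h⟩
    · exact h2.2 ⟨E, i, e, hE, h⟩

end Model

/-! ### A spanning set of the antisymmetric elements, and a commutation criterion. -/

section Sufficiency

variable {R : Type*} [CommRing R] {G : Type*} [Group G] {σ : G →* ℤˣ}

open MonoidAlgebra (single)

theorem coeff_phi (α : MonoidAlgebra R G) (x : G) :
    (phi σ α).coeff x = α.coeff x⁻¹ * (((σ x : ℤˣ) : ℤ) : R) := by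
  classical
  induction α using MonoidAlgebra.induction_linear with
  | zero => simp
  | add α β hα hβ => simp [hα, hβ, add_mul]
  | single y r =>
    rw [phi_single, MonoidAlgebra.coeff_single, MonoidAlgebra.coeff_single, Finsupp.single_apply,
      Finsupp.single_apply]
    by_cases h : y⁻¹ = x
    · have h' : y = x⁻¹ := by rw [← h, inv_inv]
      simp [h']
    · have h' : y ≠ x⁻¹ := fun e => h (by rw [e, inv_inv])
      simp [h, h']

/-- The set of standard antisymmetric elements, when there is no involution outside `N`. -/
inductive IsGenerator (σ : G →* ℤˣ) : MonoidAlgebra R G → Prop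
  | torsion (x : G) (r : R) (hx : σ x = 1) (h2 : x ^ 2 = 1) (hr : 2 * r = 0) :
      IsGenerator σ (single x r)
  | inside (x : G) (hx : σ x = 1) (h2 : x ^ 2 ≠ 1) :
      IsGenerator σ (single x 1 - single x⁻¹ 1)
  | outside (x : G) (hx : σ x = -1) (h2 : x ^ 2 ≠ 1) :
      IsGenerator σ (single x 1 + single x⁻¹ 1)

/-- Induction on the size of the support: antisymmetry ties the coefficient at `x⁻¹` to that at `x`,
so subtracting a multiple of the generator at `x` removes `x` without enlarging the support. -/
theorem mem_span_isGenerator (h3 : ∀ x, σ x = -1 → x ^ 2 ≠ 1) {α : MonoidAlgebra R G}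
    (hα : α ∈ antisymmetric R σ) : α ∈ Submodule.span R {t | IsGenerator (R := R) σ t} := by
  classical
  induction hn : α.coeff.support.card using Nat.strong_induction_on generalizing α with
  | _ n ih =>
  subst hn
  by_cases h0 : α = 0
  · rw [h0]; exact zero_mem _
  obtain ⟨x, hx⟩ : ∃ x, α.coeff x ≠ 0 := by
    by_contra! h
    exact h0 (MonoidAlgebra.ext (Finsupp.ext h))
  have hcoeff : ∀ y, α.coeff y⁻¹ * (((σ y : ℤˣ) : ℤ) : R) = - α.coeff y := fun y => by
    rw [← coeff_phi, show phi σ α = -α from hα]; simp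
  suffices ∃ t ∈ Submodule.span R {t | IsGenerator (R := R) σ t}, t ∈ antisymmetric R σ ∧
      t.coeff x = α.coeff x ∧ ∀ y, α.coeff y = 0 → t.coeff y = 0 by
    obtain ⟨t, ht, hphi, htx, hty⟩ := this
    have hβ : α - t ∈ antisymmetric R σ := by
      simp only [antisymmetric, Set.mem_ofPred_eq] at hα hphi ⊢
      rw [map_sub, hα, hphi]; abel
    have := ih _ (Finset.card_lt_card ?_) hβ rfl
    · have := add_mem this ht
      rwa [sub_add_cancel] at this
    · refine (Finset.ssubset_iff_of_subset fun y => ?_).2 ⟨x, by simpa using hx, by simp [htx]⟩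
      simp only [Finsupp.mem_support_iff, MonoidAlgebra.coeff_sub, Finsupp.sub_apply]
      intro h h'
      exact h (by rw [h', hty y h', sub_zero])
  by_cases h2 : x ^ 2 = 1
  · have hσ : σ x = 1 := (Int.units_eq_one_or _).resolve_right fun h => h3 x h h2
    have hr : 2 * α.coeff x = 0 := by
      have := hcoeff x
      rw [inv_eq_self_of_sq h2, hσ] at this
      push_cast at this
      linear_combination this
    refine ⟨single x (α.coeff x), Submodule.subset_span (.torsion x _ hσ h2 hr),
      torsion_single_mem_antisymmetric hσ h2 hr, by simp, fun y hy => ?_⟩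
    have : x ≠ y := fun e => hx (e ▸ hy)
    simp [this]
  · have hne : x⁻¹ ≠ x := fun e => h2 (by rw [sq, mul_eq_one_iff_inv_eq, e])
    have hy : ∀ y, α.coeff y = 0 → x ≠ y ∧ x⁻¹ ≠ y := fun y hy => by
      refine ⟨fun e => hx (e ▸ hy), fun e => hx ?_⟩
      rw [← neg_eq_zero, ← hcoeff, e, hy, zero_mul]
    rcases Int.units_eq_one_or (σ x) with hσ | hσ
    · refine ⟨α.coeff x • (single x 1 - single x⁻¹ 1),
        Submodule.smul_mem _ _ (Submodule.subset_span (.inside x hσ h2)), ?_, ?_, ?_⟩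
      · have := sub_inv_mem_antisymmetric (R := R) hσ
        simp only [antisymmetric, Set.mem_ofPred_eq] at this ⊢
        rw [map_smul, this, smul_neg]
      · simp [hne]
      · intro y h
        simp [hy y h]
    · refine ⟨α.coeff x • (single x 1 + single x⁻¹ 1),
        Submodule.smul_mem _ _ (Submodule.subset_span (.outside x hσ h2)), ?_, ?_, ?_⟩
      · have := add_inv_mem_antisymmetric (R := R) hσ
        simp only [antisymmetric, Set.mem_ofPred_eq] at this ⊢
        rw [map_smul, this, smul_neg]
      · simp [hne]
      · intro y h
        simp [hy y h]

theorem antisymmetricCommutative_of_isGenerator (h3 : ∀ x, σ x = -1 → x ^ 2 ≠ 1)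
    (h : ∀ s t : MonoidAlgebra R G, IsGenerator σ s → IsGenerator σ t → Commute s t) :
    AntisymmetricCommutative R σ := by
  intro x hx y hy
  change Commute x y
  refine Submodule.span_induction₂ (p := fun x y _ _ => Commute x y) (fun s t hs ht => h s t hs ht)
    ?_ ?_ ?_ ?_ ?_ ?_ (mem_span_isGenerator h3 hx) (mem_span_isGenerator h3 hy)
  · intros; exact Commute.zero_left _
  · intros; exact Commute.zero_right _
  · intros _ _ _ _ _ _ h1 h2; exact h1.add_left h2
  · intros _ _ _ _ _ _ h1 h2; exact h1.add_right h2
  · intros r _ _ _ _ h; exact h.smul_left r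
  · intros r _ _ _ _ h; exact h.smul_right r

/-- If `a` and `b` commute up to a factor `w` absorbed by `c`, then `a * c` commutes with `b`. -/
theorem commute_mul_of_absorb {A : Type*} [Ring A] {a b c w : A} (hcb : Commute c b)
    (hwa : Commute w a) (hwb : Commute w b) (hab : a * b = w * (b * a)) (hwc : w * c = c) :
    Commute (a * c) b := by
  calc a * c * b = a * b * c := by rw [mul_assoc, hcb.eq, mul_assoc]
    _ = b * a * (w * c) := by rw [hab, (hwb.mul_right hwa).eq, mul_assoc]
    _ = b * (a * c) := by rw [hwc, mul_assoc]

theorem commute_mul_mul_of_absorb {A : Type*} [Ring A] {a b c w : A} (hca : Commute c a)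
    (hcb : Commute c b) (hwa : Commute w a) (hwb : Commute w b) (hab : a * b = w * (b * a))
    (hwc : w * (c * c) = c * c) : Commute (a * c) (b * c) := by
  calc a * c * (b * c) = a * b * (c * c) := by rw [mul_assoc, ← mul_assoc c, hcb.eq]; noncomm_ring
    _ = b * a * (w * (c * c)) := by rw [hab, (hwb.mul_right hwa).eq, mul_assoc]
    _ = b * (a * c) * c := by rw [hwc]; noncomm_ring
    _ = b * c * (a * c) := by
      rw [mul_assoc b c, ← mul_assoc c a c, hca.eq, mul_assoc b (a * c)]

/-- Both products vanish, since `(1 - w) * (1 + w) = 0`. -/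
theorem commute_mul_one_sub_mul_one_add {A : Type*} [Ring A] {w : A} (hw : ∀ t, Commute w t)
    (hww : w * w = 1) (a b : A) : Commute (a * (1 - w)) (b * (1 + w)) := by
  have hdm : ∀ t, Commute (1 - w) t := fun t => (Commute.one_left t).sub_left (hw t)
  have hdp : ∀ t, Commute (1 + w) t := fun t => (Commute.one_left t).add_left (hw t)
  have e1 : (1 - w) * (1 + w) = 0 := by
    rw [mul_add, sub_mul, sub_mul, hww]; noncomm_ring
  have e2 : (1 + w) * (1 - w) = 0 := by rw [(hdp _).eq, e1]
  rw [Commute, SemiconjBy, mul_assoc, ← mul_assoc (1 - w), (hdm b).eq, mul_assoc b (1 - w), e1,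
    mul_assoc b, ← mul_assoc (1 + w), (hdp a).eq, mul_assoc a (1 + w), e2]
  simp

theorem commute_mul_one_add {A : Type*} [Ring A] {a b w : A} (hw : ∀ t, Commute w t)
    (hww : w * w = 1) (hab : a * b = b * a ∨ a * b = w * (b * a)) :
    Commute (a * (1 + w)) (b * (1 + w)) := by
  have hdp : ∀ t, Commute (1 + w) t := fun t => (Commute.one_left t).add_left (hw t)
  rcases hab with hab | hab
  · exact commute_mul_mul_of_absorb (w := 1) (hdp _) (hdp _) (.one_left _) (.one_left _)
      (by rw [one_mul, hab]) (one_mul _)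
  · refine commute_mul_mul_of_absorb (hdp _) (hdp _) (hw _) (hw _) hab ?_
    rw [← mul_assoc, mul_add w, hww, mul_one, add_comm w]

/-- Here `w` acts on `(1 - w) ^ 2 = 2 * (1 - w)` as `-1`, which is the identity once `4 = 0`. -/
theorem commute_mul_one_sub {A : Type*} [Ring A] {a b w : A} (hw : ∀ t, Commute w t)
    (hww : w * w = 1) (hab : a * b = b * a ∨ ((4 : A) = 0 ∧ a * b = w * (b * a))) :
    Commute (a * (1 - w)) (b * (1 - w)) := by
  have hdm : ∀ t, Commute (1 - w) t := fun t => (Commute.one_left t).sub_left (hw t)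
  rcases hab with hab | ⟨h4, hab⟩
  · exact commute_mul_mul_of_absorb (w := 1) (hdm _) (hdm _) (.one_left _) (.one_left _)
      (by rw [one_mul, hab]) (one_mul _)
  · refine commute_mul_mul_of_absorb (hdm _) (hdm _) (hw _) (hw _) hab ?_
    have e1 : w * (1 - w) = -(1 - w) := by rw [mul_sub, hww, mul_one, neg_sub]
    have e2 : (1 - w) * (1 - w) = 2 * (1 - w) := by
      conv_lhs => rw [sub_mul, e1, one_mul, sub_neg_eq_add, ← two_mul]
    rw [← mul_assoc, e1, neg_mul, neg_eq_iff_add_eq_zero, e2, ← two_mul, ← mul_assoc]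
    rw [show (2 : A) * 2 = 4 by norm_num, h4, zero_mul]

/-- A criterion for commutativity of the antisymmetric elements in terms of a central element `z`
with `z ^ 2 = 1`, by cases on whether elements lie in `N` and whether they square to `z`. -/
theorem antisymmetricCommutative_of_central {z : G} (hz : ∀ x, Commute z x) (hz2 : z ^ 2 = 1)
    (h1 : ∀ x, σ x = 1 → x ^ 2 = 1 ∨ x ^ 2 = z)
    (h0 : twoTorsion R = {0} ∨ ∀ x, σ x = 1 → x ^ 2 = 1 → ∀ y, Commute x y)
    (h22 : ∀ x y, σ x = 1 → σ y = 1 → x ^ 2 = z → y ^ 2 = z →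
      x * y = y * x ∨ ((4 : R) = 0 ∧ x * y = z * (y * x)))
    (h3 : ∀ x, σ x = -1 → x ^ 2 ≠ 1)
    (h33 : ∀ x y, σ x = -1 → σ y = -1 → x ^ 2 = z → y ^ 2 = z →
      x * y = y * x ∨ x * y = z * (y * x))
    (h44 : ∀ x y, σ x = -1 → σ y = -1 → x ^ 2 ≠ z → y ^ 2 ≠ z → x * y = y * x)
    (h24 : ∀ x y, σ x = 1 → σ y = -1 → x ^ 2 = z → y ^ 2 ≠ z → x * y = y * x ∨ x * y = y⁻¹ * x)
    (h34 : ∀ x y, σ x = -1 → σ y = -1 → x ^ 2 = z → y ^ 2 ≠ z →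
      x * y = y * x ∨ x * y = y⁻¹ * x ∨ x * y = z * (y * x) ∨ x * y = z * (y⁻¹ * x)) :
    AntisymmetricCommutative R σ := by
  let A := MonoidAlgebra.of R G
  have hA : ∀ x, single x (1 : R) = A x := fun _ => rfl
  have hZ : ∀ t, Commute (A z) t := MonoidAlgebra.of_commute hz
  have hZZ : A z * A z = 1 := by rw [← map_mul, ← sq, hz2, map_one]
  have hdm : ∀ t, Commute (1 - A z) t := fun t => (Commute.one_left t).sub_left (hZ t)
  have hdp : ∀ t, Commute (1 + A z) t := fun t => (Commute.one_left t).add_left (hZ t)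
  have absorb : A z * (1 + A z) = 1 + A z := by rw [mul_add, hZZ, mul_one, add_comm]
  -- Thus `x ∓ x⁻¹ = x (1 ∓ z)`.
  have hinv : ∀ x, x ^ 2 = z → x⁻¹ = x * z := fun x hx => by
    rw [inv_eq_iff_mul_eq_one, ← mul_assoc, ← sq, hx, ← sq, hz2]
  let C (t : MonoidAlgebra R G) : Prop := ∀ s, Commute t s
  have key : ∀ t : MonoidAlgebra R G, IsGenerator σ t → C t ∨
      (∃ x, σ x = 1 ∧ x ^ 2 = z ∧ t = A x * (1 - A z)) ∨
      (∃ x, σ x = -1 ∧ x ^ 2 = z ∧ t = A x * (1 + A z)) ∨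
      (∃ x, σ x = -1 ∧ x ^ 2 ≠ z ∧ t = A x + A x⁻¹) := by
    rintro _ (⟨x, r, hx, h2, hr⟩ | ⟨x, hx, h2⟩ | ⟨x, hx, h2⟩)
    · left
      rcases h0 with h0 | h0
      · have : r ∈ twoTorsion R := hr
        rw [h0, Set.mem_singleton_iff] at this
        rw [this, MonoidAlgebra.single_zero]
        exact Commute.zero_left
      · exact MonoidAlgebra.single_commute (h0 x hx h2) (Commute.all r)
    · have hxz := (h1 x hx).resolve_left h2
      refine .inr (.inl ⟨x, hx, hxz, ?_⟩)
      rw [hA, hA, hinv x hxz, map_mul, mul_sub, mul_one]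
    · right; right
      by_cases hxz : x ^ 2 = z
      · refine .inl ⟨x, hx, hxz, ?_⟩
        rw [hA, hA, hinv x hxz, map_mul, mul_add, mul_one]
      · exact .inr ⟨x, hx, hxz, rfl⟩
  have c23 : ∀ x y, Commute (A x * (1 - A z)) (A y * (1 + A z)) := fun x y =>
    commute_mul_one_sub_mul_one_add hZ hZZ _ _
  have c22 : ∀ x y, σ x = 1 → σ y = 1 → x ^ 2 = z → y ^ 2 = z →
      Commute (A x * (1 - A z)) (A y * (1 - A z)) := by
    intro x y hx hy hxz hyz
    refine commute_mul_one_sub hZ hZZ ?_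
    simp only [← map_mul]
    refine (h22 x y hx hy hxz hyz).imp (congrArg A) fun ⟨h4, h⟩ => ⟨?_, congrArg A h⟩
    have := congrArg (algebraMap R (MonoidAlgebra R G)) h4
    rwa [map_ofNat, map_zero] at this
  have c33 : ∀ x y, σ x = -1 → σ y = -1 → x ^ 2 = z → y ^ 2 = z →
      Commute (A x * (1 + A z)) (A y * (1 + A z)) := by
    intro x y hx hy hxz hyz
    refine commute_mul_one_add hZ hZZ ?_
    simp only [← map_mul]
    exact (h33 x y hx hy hxz hyz).imp (congrArg A) (congrArg A)
  have c44 : ∀ x y, σ x = -1 → σ y = -1 → x ^ 2 ≠ z → y ^ 2 ≠ z →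
      Commute (A x + A x⁻¹) (A y + A y⁻¹) := by
    intro x y hx hy hxz hyz
    have h : Commute x y := h44 x y hx hy hxz hyz
    exact (((h.map A).add_right (h.inv_right.map A))).add_left
      ((h.inv_left.map A).add_right (h.inv_inv.map A))
  have c24 : ∀ x y, σ x = 1 → σ y = -1 → x ^ 2 = z → y ^ 2 ≠ z →
      Commute (A x * (1 - A z)) (A y + A y⁻¹) := by
    intro x y hx hy hxz hyz
    refine Commute.mul_left ?_ (hdm _)
    rcases h24 x y hx hy hxz hyz with h | h
    · have h : Commute x y := h
      exact (h.map A).add_right (h.inv_right.map A)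
    · have h' : x * y⁻¹ = y * x := by simpa using (SemiconjBy.inv_right (a := x) h).eq
      rw [Commute, SemiconjBy, mul_add, add_mul, ← map_mul, ← map_mul, ← map_mul, ← map_mul, h, h',
        add_comm]
  have c34 : ∀ x y, σ x = -1 → σ y = -1 → x ^ 2 = z → y ^ 2 ≠ z →
      Commute (A x * (1 + A z)) (A y + A y⁻¹) := by
    intro x y hx hy hxz hyz
    have hzi : z⁻¹ = z := inv_eq_self_of_sq hz2
    rcases h34 x y hx hy hxz hyz with h | h | h | h
    · have h : Commute x y := h
      exact ((h.map A).add_right (h.inv_right.map A)).mul_left (hdp _)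
    · have h' : x * y⁻¹ = y * x := by simpa using (SemiconjBy.inv_right (a := x) h).eq
      refine Commute.mul_left ?_ (hdp _)
      rw [Commute, SemiconjBy, mul_add, add_mul, ← map_mul, ← map_mul, ← map_mul, ← map_mul, h, h',
        add_comm]
    · have h' : x * y⁻¹ = z * (y⁻¹ * x) := by
        rw [← mul_assoc] at h ⊢
        rw [(SemiconjBy.inv_right (a := x) h).eq, mul_inv_rev, hzi, ← (hz y⁻¹).eq]
      refine commute_mul_of_absorb (hdp _) (hZ _) (hZ _) ?_ absorb
      rw [mul_add, add_mul, mul_add (A z), ← map_mul, ← map_mul, ← map_mul, ← map_mul, ← map_mul,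
        ← map_mul, h, h']
    · have h' : x * y⁻¹ = z * (y * x) := by
        rw [← mul_assoc] at h ⊢
        rw [(SemiconjBy.inv_right (a := x) h).eq, mul_inv_rev, inv_inv, hzi, ← (hz y).eq]
      refine commute_mul_of_absorb (hdp _) (hZ _) (hZ _) ?_ absorb
      rw [mul_add, add_mul, mul_add (A z), ← map_mul, ← map_mul, ← map_mul, ← map_mul, ← map_mul,
        ← map_mul, h, h', add_comm]
  refine antisymmetricCommutative_of_isGenerator h3 fun s t hs ht => ?_
  rcases key s hs with hs | ⟨x, hx, hxz, rfl⟩ | ⟨x, hx, hxz, rfl⟩ | ⟨x, hx, hxz, rfl⟩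
  · exact hs t
  all_goals rcases key t ht with ht | ⟨y, hy, hyz, rfl⟩ | ⟨y, hy, hyz, rfl⟩ | ⟨y, hy, hyz, rfl⟩
  · exact (ht _).symm
  · exact c22 x y hx hy hxz hyz
  · exact c23 x y
  · exact c24 x y hx hy hxz hyz
  · exact (ht _).symm
  · exact (c23 y x).symm
  · exact c33 x y hx hy hxz hyz
  · exact c34 x y hx hy hxz hyz
  · exact (ht _).symm
  · exact (c24 y x hy hx hyz hxz).symm
  · exact (c34 y x hy hx hyz hxz).symm
  · exact c44 x y hx hy hxz hyz

end Sufficiency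

/-! ### Finite verification of the criterion in the models. -/

section Application

variable {R : Type*} [CommRing R] {G : Type v} [Group G] {σ : G →* ℤˣ}

namespace Model

variable {κ : Kind}

theorem g_pow_four_commute : ∀ p : Model κ, g ^ 4 * p = p * g ^ 4 := by cases κ <;> decide +kernel

theorem g_pow_four_sq : (g ^ 4 : Model κ) ^ 2 = 1 := by cases κ <;> decide +kernel

theorem sq_eq_of_orient_eq_one :
    ∀ p : Model κ, orient κ p = 1 → p ^ 2 = 1 ∨ p ^ 2 = g ^ 4 := by cases κ <;> decide +kernel

theorem sq_ne_one_of_orient :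
    ∀ p : Model κ, orient κ p = -1 → p ^ 2 ≠ 1 := by cases κ <;> decide +kernel

theorem quaternion_central : ∀ p : Model .quaternion, orient .quaternion p = 1 → p ^ 2 = 1 →
    ∀ q, p * q = q * p := by decide +kernel

theorem semidihedral_inside : ∀ p q : Model .semidihedral, orient .semidihedral p = 1 →
    orient .semidihedral q = 1 → p ^ 2 = g ^ 4 → q ^ 2 = g ^ 4 → p * q = q * p := by decide +kernel

theorem quaternion_inside : ∀ p q : Model .quaternion, orient .quaternion p = 1 →
    orient .quaternion q = 1 → p * q = q * p ∨ p * q = g ^ 4 * (q * p) := by decide +kernel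

theorem outside_of_sq_eq : ∀ p q : Model κ, orient κ p = -1 → orient κ q = -1 → p ^ 2 = g ^ 4 →
    q ^ 2 = g ^ 4 → p * q = q * p ∨ p * q = g ^ 4 * (q * p) := by cases κ <;> decide +kernel

theorem outside_of_sq_ne : ∀ p q : Model κ, orient κ p = -1 → orient κ q = -1 → p ^ 2 ≠ g ^ 4 →
    q ^ 2 ≠ g ^ 4 → p * q = q * p := by cases κ <;> decide +kernel

theorem inside_outside : ∀ p q : Model κ, orient κ p = 1 → orient κ q = -1 → p ^ 2 = g ^ 4 →
    q ^ 2 ≠ g ^ 4 → p * q = q * p ∨ p * q = q⁻¹ * p := by cases κ <;> decide +kernel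

theorem outside_outside : ∀ p q : Model κ, orient κ p = -1 → orient κ q = -1 → p ^ 2 = g ^ 4 →
    q ^ 2 ≠ g ^ 4 → p * q = q * p ∨ p * q = q⁻¹ * p ∨ p * q = g ^ 4 * (q * p) ∨
      p * q = g ^ 4 * (q⁻¹ * p) := by cases κ <;> decide +kernel

end Model

/-- Sufficiency of the structural conditions. -/
theorem antisymmetricCommutative_of_isModelProduct {κ : Kind} (h : IsModelProduct σ κ)
    (hκ : (κ = .semidihedral ∧ twoTorsion R = {0}) ∨ (κ = .quaternion ∧ (4 : R) = 0)) :
    AntisymmetricCommutative R σ := by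
  obtain ⟨E, _, e, hE, hσ⟩ := h
  let z : Model κ × E := (Model.g ^ 4, 1)
  -- `E` is abelian and its elements are their own inverses, so every relation needed can be read
  -- off the model component.
  have hsq : ∀ (p : Model κ) (ε : E) (w : Model κ), (p, ε) ^ 2 = (w, (1 : E)) ↔ p ^ 2 = w := by
    intro p ε w
    rw [Prod.ext_iff]
    exact ⟨fun h => h.1, fun h => ⟨h, hE ε⟩⟩
  have hi : ∀ ε : E, ε⁻¹ = ε := fun ε => inv_eq_self_of_sq (hE ε)
  have hsq' : ∀ (p : Model κ) (ε : E) (w : Model κ),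
      e.symm (p, ε) ^ 2 = e.symm (w, 1) ↔ p ^ 2 = w := by
    intro p ε w
    rw [← hsq p ε w, ← map_pow, e.symm.injective.eq_iff]
  have hsq1 : ∀ (p : Model κ) (ε : E), e.symm (p, ε) ^ 2 = 1 ↔ p ^ 2 = 1 := by
    intro p ε
    rw [← hsq' p ε 1]
    exact Eq.congr_right (map_one e.symm).symm
  have hor : ∀ p ε, σ (e.symm (p, ε)) = Model.orient κ p := fun p ε => by
    rw [hσ, e.apply_symm_apply]
  have hmul : ∀ (p q : Model κ) (ε δ : E), p * q = q * p →
      e.symm (p, ε) * e.symm (q, δ) = e.symm (q, δ) * e.symm (p, ε) := by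
    intro p q ε δ h
    rw [← map_mul, ← map_mul, Prod.mk_mul_mk, Prod.mk_mul_mk, h, mul_comm ε]
  have hmulz : ∀ (p q : Model κ) (ε δ : E), p * q = Model.g ^ 4 * (q * p) →
      e.symm (p, ε) * e.symm (q, δ) = e.symm z * (e.symm (q, δ) * e.symm (p, ε)) := by
    intro p q ε δ h
    simp only [← map_mul, z, Prod.mk_mul_mk, h, mul_comm ε, one_mul]
  have hmuli : ∀ (p q : Model κ) (ε δ : E), p * q = q⁻¹ * p →
      e.symm (p, ε) * e.symm (q, δ) = (e.symm (q, δ))⁻¹ * e.symm (p, ε) := by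
    intro p q ε δ h
    simp only [← map_mul, ← map_inv, Prod.mk_mul_mk, Prod.inv_mk, h, mul_comm ε, hi]
  have hmulzi : ∀ (p q : Model κ) (ε δ : E), p * q = Model.g ^ 4 * (q⁻¹ * p) →
      e.symm (p, ε) * e.symm (q, δ) = e.symm z * ((e.symm (q, δ))⁻¹ * e.symm (p, ε)) := by
    intro p q ε δ h
    simp only [← map_mul, ← map_inv, z, Prod.mk_mul_mk, Prod.inv_mk, h, mul_comm ε, hi, one_mul]
  have surj : ∀ P : G → Prop, (∀ p ε, P (e.symm (p, ε))) → ∀ x, P x := fun P h x => by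
    have := h (e x).1 (e x).2
    rwa [e.symm_apply_apply] at this
  apply antisymmetricCommutative_of_central (z := e.symm z)
  · refine surj _ fun p ε => hmul _ _ _ _ (Model.g_pow_four_commute p)
  · exact (hsq1 _ _).2 Model.g_pow_four_sq
  · refine surj _ fun p ε => ?_
    rw [hor, hsq1, hsq']
    exact Model.sq_eq_of_orient_eq_one p
  · refine hκ.imp (fun h => h.2) ?_
    rintro ⟨rfl, -⟩
    refine surj _ fun p ε => ?_
    rw [hor, hsq1]
    exact fun h1 h2 => surj _ fun q δ => hmul _ _ _ _ (Model.quaternion_central p h1 h2 q)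
  · refine surj _ fun p ε => surj _ fun q δ => ?_
    rw [hor, hor, hsq', hsq']
    rcases hκ with ⟨rfl, -⟩ | ⟨rfl, h4⟩
    · exact fun h1 h2 h3 h4 => .inl (hmul _ _ _ _ (Model.semidihedral_inside p q h1 h2 h3 h4))
    · exact fun h1 h2 _ _ => (Model.quaternion_inside p q h1 h2).imp (hmul _ _ _ _)
        fun h => ⟨h4, hmulz _ _ _ _ h⟩
  · refine surj _ fun p ε => ?_
    rw [hor, Ne, hsq1]
    exact Model.sq_ne_one_of_orient p
  · refine surj _ fun p ε => surj _ fun q δ => ?_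
    rw [hor, hor, hsq', hsq']
    exact fun h1 h2 h3 h4 => (Model.outside_of_sq_eq p q h1 h2 h3 h4).imp (hmul _ _ _ _)
      (hmulz _ _ _ _)
  · refine surj _ fun p ε => surj _ fun q δ => ?_
    rw [hor, hor, Ne, hsq', Ne, hsq']
    exact fun h1 h2 h3 h4 => hmul _ _ _ _ (Model.outside_of_sq_ne p q h1 h2 h3 h4)
  · refine surj _ fun p ε => surj _ fun q δ => ?_
    rw [hor, hor, hsq', Ne, hsq']
    exact fun h1 h2 h3 h4 => (Model.inside_outside p q h1 h2 h3 h4).imp (hmul _ _ _ _)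
      (hmuli _ _ _ _)
  · refine surj _ fun p ε => surj _ fun q δ => ?_
    rw [hor, hor, hsq', Ne, hsq']
    exact fun h1 h2 h3 h4 => (Model.outside_outside p q h1 h2 h3 h4).imp (hmul _ _ _ _)
      (Or.imp (hmuli _ _ _ _) (Or.imp (hmulz _ _ _ _) (hmulzi _ _ _ _)))

end Application

/-! ### Splitting off an involution. -/

section Complement

/-- By Zorn's lemma, take `E` maximal among the subgroups avoiding `z`; this covers infinite `A` as
well. -/
theorem exists_complement_of_involution {A : Type*} [CommGroup A]
    (hA : IsElementaryAbelianTwo A) {z : A} (hz : z ≠ 1) :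
    ∃ E : Subgroup A, z ∉ E ∧ ∀ x, x ∈ E ∨ z * x ∈ E := by
  obtain ⟨E, -, hE⟩ := zorn_le_nonempty₀ {E : Subgroup A | z ∉ E} (fun c hc hchain E hEc => by
    refine ⟨sSup c, fun hmem => ?_, fun F hF => le_sSup hF⟩
    rw [Subgroup.mem_sSup_of_directedOn ⟨E, hEc⟩ hchain.directedOn] at hmem
    obtain ⟨F, hF, hzF⟩ := hmem
    exact hc hF hzF) ⊥ (by simpa using hz)
  refine ⟨E, hE.prop, fun x => or_iff_not_imp_left.2 fun hx => ?_⟩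
  have hzE : z ∈ E ⊔ Subgroup.zpowers x := by
    by_contra h
    exact hx (hE.le_of_ge h le_sup_left (Subgroup.mem_sup_right (Subgroup.mem_zpowers x)))
  obtain ⟨y, hy, w, hw, rfl⟩ := Subgroup.mem_sup.1 hzE
  obtain ⟨n, rfl⟩ := Subgroup.mem_zpowers_iff.1 hw
  -- Here `z = y * x ^ n` with `y ∈ E`. An even `n` would put `z` in `E`; an odd one gives `z * x =
  -- y`.
  rcases Int.even_or_odd' n with ⟨k, rfl | rfl⟩
  · refine absurd ?_ hE.prop
    rw [zpow_mul, zpow_ofNat, hA, one_zpow, mul_one]; exact hy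
  · rw [zpow_add, zpow_mul, zpow_ofNat, hA, one_zpow, one_mul, zpow_one, mul_assoc, ← sq, hA,
      mul_one]
    exact hy

end Complement

/-! ### Recognizing `G` as a product of a model and `E`. -/

section Necessity

variable {R : Type*} [CommRing R] {G : Type v} [Group G] {σ : G →* ℤˣ}

/-- `Ω` consists of the elements squaring to `1` in the centralizer of `g` in `N`, and `E` is a
complement of `⟨g ^ 4⟩` in it. Both `g` and `h` centralize `E`, so multiplication defines a
homomorphism from the product. -/
theorem isModelProduct_of_generators {κ : Kind} {g h : G} (hg : σ g = -1) (hh : σ h = 1)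
    (hg8 : g ^ 8 = 1) (hg4 : g ^ 4 ≠ 1) (hhh : h * h = g ^ κ.square.val)
    (hhg : SemiconjBy h g (g ^ κ.twist.val)) (hnc : ¬ Commute h g)
    (hcov : ∀ x, σ x = 1 → Commute x g ∨ Commute (h⁻¹ * x) g)
    (hab : ∀ x y, σ x = 1 → σ y = 1 → Commute x g → Commute y g → Commute x y)
    (hinv : ∀ x, σ x = 1 → Commute x g → SemiconjBy h x x⁻¹)
    (hsq : ∀ x, σ x = 1 → Commute x g → x ^ 2 = 1 ∨ x ^ 2 = g ^ 4) :
    IsModelProduct σ κ := by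
  let Ω : Subgroup G :=
    { carrier := {x | σ x = 1 ∧ Commute x g ∧ x ^ 2 = 1}
      one_mem' := ⟨map_one _, Commute.one_left _, one_pow _⟩
      mul_mem' := fun {x y} hx hy => ⟨by rw [map_mul, hx.1, hy.1, one_mul], hx.2.1.mul_left hy.2.1,
        by rw [(hab x y hx.1 hy.1 hx.2.1 hy.2.1).mul_pow, hx.2.2, hy.2.2, one_mul]⟩
      inv_mem' := fun {x} hx => ⟨by rw [map_inv, hx.1, inv_one], hx.2.1.inv_left,
        by rw [inv_pow, hx.2.2, inv_one]⟩ }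
  let _ : CommGroup Ω :=
    { (inferInstance : Group Ω) with
      mul_comm := fun x y => Subtype.ext (hab x y x.2.1 y.2.1 x.2.2.1 y.2.2.1) }
  have hΩ : IsElementaryAbelianTwo Ω := fun x => Subtype.ext x.2.2.2
  have hgg : ∀ n, Commute (g ^ n) g := fun n => (Commute.refl g).pow_left n
  let z : Ω := ⟨g ^ 4, by rw [map_pow, hg]; rfl, hgg 4, by rw [← pow_mul, hg8]⟩
  have hz : z ≠ 1 := fun h => hg4 (congrArg Subtype.val h)
  obtain ⟨E, hzE, hE⟩ := exists_complement_of_involution hΩ hz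
  let f := Model.hom κ hg8 hhh hhg
  let ι : E →* G := Ω.subtype.comp E.subtype
  have hcomm : ∀ p ε, Commute (f p) (ι ε) := by
    intro p ε
    have hεg : Commute g (ι ε) := ε.1.2.2.1.symm
    refine (hεg.pow_left _).mul_left ?_
    cases p.refl
    · exact Commute.one_left _
    · have := hinv _ ε.1.2.1 ε.1.2.2.1
      rwa [inv_eq_self_of_sq ε.1.2.2.2] at this
  let φ : Model κ × E →* G := MonoidHom.noncommCoprod f ι hcomm
  have hφ : ∀ p ε, φ (p, ε) = f p * ι ε := fun _ _ => rfl
  have hinj : Function.Injective φ := by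
    rw [injective_iff_map_eq_one]
    rintro ⟨⟨i, r⟩, ε⟩ h1
    rw [hφ, mul_eq_one_iff_eq_inv, ← map_inv] at h1
    have hε := (ε⁻¹).1.2
    have h1 : g ^ i.val * (bif r then h else 1) = ι ε⁻¹ := h1
    cases r
    · rw [cond_false, mul_one] at h1
      -- A power of `g` lying in `E` squares to `1`, so it is `1` or `g ^ 4`, and `E` avoids the
      -- latter.
      have h2 : g ^ (i.val * 2) = 1 := by rw [pow_mul, h1]; exact hε.2.2
      have ho : orderOf g = 8 := orderOf_eq_prime_pow (p := 2) (n := 2) hg4 hg8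
      have hdvd := orderOf_dvd_of_pow_eq_one h2
      rw [ho] at hdvd
      have hlt := ZMod.val_lt i
      have h04 : i.val = 0 ∨ i.val = 4 := by omega
      rcases h04 with h0 | h0
      · rw [h0, pow_zero] at h1
        have hi : i = 0 := (ZMod.val_eq_zero i).1 h0
        have hε1 : ε⁻¹ = 1 := Subtype.ext (Subtype.ext h1.symm)
        rw [inv_eq_one.1 hε1, hi]; rfl
      · rw [h0] at h1
        refine absurd ?_ hzE
        have : z = (ε⁻¹).1 := Subtype.ext h1
        rw [this]; exact (ε⁻¹).2
    · refine absurd ?_ hnc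
      have : h = (g ^ i.val)⁻¹ * ι ε⁻¹ := by rw [← h1]; simp
      rw [this]
      exact (hgg _).inv_left.mul_left hε.2.1
  have hgR : g ∈ φ.range := ⟨(Model.g, 1), by
    rw [hφ, map_one, mul_one]; exact Model.hom_g _ _ _⟩
  have hhR : h ∈ φ.range := ⟨(Model.u, 1), by
    rw [hφ, map_one, mul_one]; exact Model.hom_u _ _ _⟩
  have hER : ∀ x : Ω, x ∈ E → (x : G) ∈ φ.range := fun x hx => ⟨(1, ⟨x, hx⟩), by
    rw [hφ, map_one, one_mul]; rfl⟩
  have hΩR : ∀ x ∈ Ω, x ∈ φ.range := by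
    intro x hx
    rcases hE ⟨x, hx⟩ with h1 | h1
    · exact hER _ h1
    · exact (Subgroup.mul_mem_cancel_left _ (pow_mem hgR 4)).1 (hER _ h1)
  have hCR : ∀ x, σ x = 1 → Commute x g → x ∈ φ.range := by
    intro x hx hxg
    rcases hsq x hx hxg with h1 | h1
    · exact hΩR x ⟨hx, hxg, h1⟩
    -- If `x ^ 2 = g ^ 4`, then `g ^ 2 * x` lies in `Ω`.
    · refine (Subgroup.mul_mem_cancel_left _ (pow_mem hgR 2)).1 (hΩR _ ⟨?_, ?_, ?_⟩)
      · simp [hg, hx]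
      · exact (hgg 2).mul_left hxg
      · rw [((hxg.symm).pow_left 2).mul_pow, h1, ← pow_mul, ← pow_add, hg8]
  have hNR : ∀ x, σ x = 1 → x ∈ φ.range := by
    intro x hx
    rcases hcov x hx with h1 | h1
    · exact hCR x hx h1
    · exact (Subgroup.mul_mem_cancel_left _ (inv_mem hhR)).1 (hCR _ (by simp [hh, hx]) h1)
  have hsurj : Function.Surjective φ := by
    intro x
    change x ∈ φ.range
    by_cases hx : σ x = 1
    · exact hNR x hx
    · exact (Subgroup.mul_mem_cancel_left _ hgR).1
        (hNR _ (by rw [map_mul, hg, sigma_eq_neg_one hx]; rfl))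
  have hσ : ∀ q, σ (φ q) = Model.orient κ q.1 := by
    rintro ⟨p, ε⟩
    have h1 : σ.comp f = Model.orient κ :=
      Model.hom_ext (by rw [MonoidHom.comp_apply, Model.hom_g, hg, Model.orient_g])
        (by rw [MonoidHom.comp_apply, Model.hom_u, hh, Model.orient_u])
    have h2 : σ (ι ε) = 1 := ε.1.2.1
    rw [hφ, map_mul, h2, mul_one, ← h1]; rfl
  refine ⟨E, inferInstance, (MulEquiv.ofBijective φ ⟨hinj, hsurj⟩).symm,
    fun ε => Subtype.ext (hΩ ε.1), fun x => ?_⟩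
  rw [← hσ]
  exact congrArg σ ((MulEquiv.ofBijective φ ⟨hinj, hsurj⟩).apply_symm_apply x).symm

theorem _root_.SemiconjBy.right_unique {a x y y' : G} (h : SemiconjBy a x y)
    (h' : SemiconjBy a x y') : y = y' :=
  mul_right_cancel (h.symm.trans h')

theorem odd_pow_pow_four_ne {g x : G} (hg8 : g ^ 8 = 1) (hg4 : g ^ 4 ≠ 1) (hx4 : x ^ 4 = 1)
    (hxg : Commute x g) {k : ℕ} (hk : k = 1 ∨ k = 3) : (g ^ k * x) ^ 4 ≠ 1 := by
  rw [((hxg.pow_right k).symm).mul_pow, hx4, mul_one]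
  rcases hk with rfl | rfl
  · rwa [pow_one]
  · rwa [← pow_mul, show 3 * 4 = 8 + 4 from rfl, pow_add, hg8, one_mul]

/-- If `y` does not commute with `x`, it does not commute with `g * x` or `g ^ 3 * x` either, so it
cubes or inverts both. As `y` fixes `g`, this gives two values for the conjugate of `x` by `y`,
differing by the factor `g ^ 4`. -/
theorem commute_of_commute_order_eight (H : AntisymmetricCommutative R σ) (h2 : (2 : R) ≠ 0)
    (h4 : ∀ x : G, σ x = 1 → x ^ 4 = 1) {g x y : G} (hg : σ g = -1) (hg8 : g ^ 8 = 1)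
    (h8 : ∀ x : G, x ^ 8 = 1)
    (hg4 : g ^ 4 ≠ 1) (hx : σ x = 1) (hy : σ y = 1) (hxg : Commute x g) (hyg : Commute y g) :
    Commute x y := by
  by_contra hc
  have hgx : ∀ k : ℕ, k = 1 ∨ k = 3 → σ (g ^ k * x) = -1 := by
    rintro k (rfl | rfl) <;> simp [hg, hx]; rfl
  have hnc : ∀ k, ¬ Commute y (g ^ k * x) := fun k h => hc (by
    have := ((hyg.pow_right k).inv_right.mul_right h)
    rw [inv_mul_cancel_left] at this
    exact this.symm)
  by_cases hy2 : y ^ 2 = 1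
  · have key : ∀ k, k = 1 ∨ k = 3 → SemiconjBy y x (g ^ (2 * k) * x ^ 3) := by
      intro k hk
      have h1 := semiconjBy_pow_three H h2 hy hy2 (hgx k hk)
        (odd_pow_pow_four_ne hg8 hg4 (h4 x hx) hxg hk) (h8 _) (hnc k)
      have h1 := SemiconjBy.mul_right (hyg.pow_right k).inv_right h1
      rw [inv_mul_cancel_left, ((hxg.pow_right k).symm).mul_pow] at h1
      rwa [show (g ^ k)⁻¹ * ((g ^ k) ^ 3 * x ^ 3) = g ^ (2 * k) * x ^ 3 by
        rw [← mul_assoc]; group] at h1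
    have := mul_right_cancel ((key 1 (.inl rfl)).right_unique (key 3 (.inr rfl)))
    apply hg4
    rw [show 2 * 3 = 4 + 2 * 1 from rfl, pow_add] at this
    exact (mul_eq_right.1 this.symm)
  · have key : ∀ k, k = 1 ∨ k = 3 → SemiconjBy y x ((g ^ (2 * k))⁻¹ * x⁻¹) := by
      intro k hk
      have h1 := (commute_or_semiconjBy_inv H h2 h4 hy hy2 (hgx k hk)
        (odd_pow_pow_four_ne hg8 hg4 (h4 x hx) hxg hk)).resolve_left (hnc k)
      have h1 := SemiconjBy.mul_right (hyg.pow_right k).inv_right h1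
      rw [inv_mul_cancel_left, ((hxg.pow_right k).symm).mul_inv] at h1
      rwa [show (g ^ k)⁻¹ * ((g ^ k)⁻¹ * x⁻¹) = (g ^ (2 * k))⁻¹ * x⁻¹ by
        rw [← mul_assoc]; group] at h1
    have := inv_injective (mul_right_cancel ((key 1 (.inl rfl)).right_unique (key 3 (.inr rfl))))
    apply hg4
    rw [show 2 * 3 = 4 + 2 * 1 from rfl, pow_add] at this
    exact (mul_eq_right.1 this.symm)

/-- `h` centralizes or inverts each of `g * x` and `g ^ 3 * x`. Inverting one of them settles the
claim, and centralizing both would give `g ^ 2 = g ^ 6`. -/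
theorem semiconjBy_inv_of_inverts (H : AntisymmetricCommutative R σ) (h2 : (2 : R) ≠ 0)
    (h4 : ∀ x : G, σ x = 1 → x ^ 4 = 1) {g h x : G} (hg : σ g = -1) (hg8 : g ^ 8 = 1)
    (hg4 : g ^ 4 ≠ 1) (hx : σ x = 1) (hh : σ h = 1) (hxg : Commute x g) (hh2 : h ^ 2 ≠ 1)
    (hhg : SemiconjBy h g g⁻¹) : SemiconjBy h x x⁻¹ := by
  have hgx : ∀ k : ℕ, k = 1 ∨ k = 3 → σ (g ^ k * x) = -1 := by
    rintro k (rfl | rfl) <;> simp [hg, hx]; rfl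
  by_contra hc
  have key : ∀ k, k = 1 ∨ k = 3 → SemiconjBy h x (g ^ (2 * k) * x) := by
    intro k hk
    have hk' := (hhg.pow_right k).inv_right
    rcases commute_or_semiconjBy_inv H h2 h4 hh hh2 (hgx k hk)
      (odd_pow_pow_four_ne hg8 hg4 (h4 x hx) hxg hk) with h1 | h1
    · have h1 := SemiconjBy.mul_right hk' h1
      rwa [show (g⁻¹ ^ k)⁻¹ * (g ^ k * x) = g ^ (2 * k) * x by
        rw [← mul_assoc]; group, inv_mul_cancel_left] at h1
    · have h1 := SemiconjBy.mul_right hk' h1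
      rw [inv_mul_cancel_left, ((hxg.pow_right k).symm).mul_inv, inv_pow, inv_inv,
        mul_inv_cancel_left] at h1
      exact absurd h1 hc
  have := mul_right_cancel ((key 1 (.inl rfl)).right_unique (key 3 (.inr rfl)))
  apply hg4
  rw [show 2 * 3 = 4 + 2 * 1 from rfl, pow_add] at this
  exact (mul_eq_right.1 this.symm)

theorem isModelProduct_quaternion_of_inverts (H : AntisymmetricCommutative R σ)
    (h2 : (2 : R) ≠ 0) (h8 : ∀ x : G, x ^ 8 = 1) (h4 : ∀ x : G, σ x = 1 → x ^ 4 = 1) {g h : G}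
    (hg : σ g = -1) (hg4 : g ^ 4 ≠ 1) (hh : σ h = 1) (hh2 : h ^ 2 ≠ 1) (hnc : ¬ Commute h g)
    (hhg : SemiconjBy h g g⁻¹) : (4 : R) = 0 ∧ IsModelProduct σ .quaternion := by
  have hinv : ∀ x, σ x = 1 → Commute x g → SemiconjBy h x x⁻¹ := fun x hx hxg =>
    semiconjBy_inv_of_inverts H h2 h4 hg (h8 g) hg4 hx hh hxg hh2 hhg
  -- `h` inverts `x`, so `(x * h) ^ 2 = h ^ 2 ≠ 1` and `four_eq_zero_of_inverts` applies. The choice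
  -- `x = g ^ 2` then yields `h ^ 2 = g ^ 4`.
  have hquat : ∀ x, σ x = 1 → Commute x g → x ^ 2 ≠ 1 → x ^ 2 = (h ^ 2)⁻¹ ∧ (4 : R) = 0 := by
    intro x hx hxg hx2
    have hxh : x * h = h * x⁻¹ := by simpa using (hinv x hx hxg).inv_right.eq.symm
    have := four_eq_zero_of_inverts H h2 hx hh hx2 hh2 hxh (by
      rwa [sq, hxh, mul_assoc, ← hxh, inv_mul_cancel_left, ← sq])
    exact ⟨sq_eq_inv_sq_of_mul_eq this.1, this.2⟩
  obtain ⟨hz, h40⟩ := hquat (g ^ 2) (by rw [map_pow, hg]; rfl) ((Commute.refl g).pow_left 2)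
    (by rwa [← pow_mul])
  rw [← pow_mul] at hz
  have hg4inv : (g ^ 4)⁻¹ = g ^ 4 := inv_eq_self_of_sq (by rw [← pow_mul, h8])
  have hhh : h ^ 2 = g ^ 4 := by rw [← hg4inv, hz, inv_inv]
  have hginv : g⁻¹ = g ^ 7 := inv_eq_of_mul_eq_one_right (by rw [← pow_succ', h8])
  refine ⟨h40, isModelProduct_of_generators hg hh (h8 g) hg4 (by rw [← sq]; exact hhh)
    (by rw [hginv] at hhg; exact hhg) hnc (fun x hx => ?_)
    (fun x y hx hy hxg hyg => commute_of_commute_order_eight H h2 h4 hg (h8 g) h8 hg4 hx hy hxg hyg)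
    hinv fun x hx hxg => ?_⟩
  · refine or_iff_not_imp_left.2 fun hxg => ?_
    have hinvg : ∀ y, σ y = 1 → y ^ 2 ≠ 1 → ¬ Commute y g → SemiconjBy y g g⁻¹ :=
      fun y hy hy2 hyg => (commute_or_semiconjBy_inv H h2 h4 hy hy2 hg hg4).resolve_left hyg
    have hh' : SemiconjBy h⁻¹ g⁻¹ g := hhg.inv_symm_left
    by_cases hx2 : x ^ 2 = 1
    -- An element of `N` can take `g` only to `g`, `g ^ 3` or `g⁻¹`, so the image `(g ^ 3)⁻¹` is
    -- impossible: no involution of `N` moves `g`.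
    · have h5 : SemiconjBy (h⁻¹ * x) g (g ^ 3)⁻¹ := by
        have h3 := semiconjBy_pow_three H h2 hx hx2 hg hg4 (h8 g) hxg
        have hh3 := (hh'.inv_right.pow_right 3).mul_left (by rwa [inv_inv])
        rwa [inv_pow] at hh3
      by_contra hc
      have hσ : σ (h⁻¹ * x) = 1 := by simp [hh, hx]
      by_cases hhx : (h⁻¹ * x) ^ 2 = 1
      · have := h5.right_unique (semiconjBy_pow_three H h2 hσ hhx hg hg4 (h8 g) hc)
        rw [inv_eq_iff_mul_eq_one, ← pow_add] at this
        have h6 := h8 g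
        rw [show 8 = 3 + 3 + 2 from rfl, pow_add, this, one_mul] at h6
        exact pow_two_ne_one hg4 h6
      · have := inv_injective (h5.right_unique (hinvg _ hσ hhx hc))
        rw [pow_succ, mul_eq_right] at this
        exact pow_two_ne_one hg4 this
    · exact hh'.mul_left (hinvg x hx hx2 hxg)
  · by_cases hx2 : x ^ 2 = 1
    · exact .inl hx2
    · right; rw [(hquat x hx hxg hx2).1, hhh, hg4inv]

theorem isModelProduct_semidihedral_of_cubes (H : AntisymmetricCommutative R σ)
    (h2 : (2 : R) ≠ 0) (h8 : ∀ x : G, x ^ 8 = 1) (h4 : ∀ x : G, σ x = 1 → x ^ 4 = 1) {g h : G}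
    (hg : σ g = -1) (hg4 : g ^ 4 ≠ 1) (hh : σ h = 1) (hh2 : h ^ 2 = 1) (hnc : ¬ Commute h g)
    (hall : ∀ x, σ x = 1 → ¬ Commute x g → x ^ 2 = 1) :
    twoTorsion R = {0} ∧ IsModelProduct σ .semidihedral := by
  have cubes : ∀ x, σ x = 1 → ¬ Commute x g → SemiconjBy x g (g ^ 3) := fun x hx hxg =>
    semiconjBy_pow_three H h2 hx (hall x hx hxg) hg hg4 (h8 g) hxg
  have hhg := cubes h hh hnc
  have hhi := inv_eq_self_of_sq hh2
  have hinv : ∀ x, σ x = 1 → Commute x g → SemiconjBy h x x⁻¹ := fun x hx hxg => by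
    -- `h * x` does not commute with `g` either, so both `h` and `h * x` are involutions, and `h`
    -- inverts `x`.
    have hhx : (h * x) ^ 2 = 1 := hall _ (by simp [hh, hx]) fun hc => hnc (by
      have := hc.mul_left hxg.inv_left
      rwa [mul_inv_cancel_right] at this)
    have := inv_eq_self_of_sq hhx
    rw [mul_inv_rev, hhi] at this
    exact this.symm
  have hv2 : (g * h) ^ 2 = g ^ 4 := by
    rw [sq, mul_assoc, ← mul_assoc h, hhg.eq, mul_assoc, ← sq, hh2, mul_one, ← pow_succ']
  have hg4inv : (g ^ 4)⁻¹ = g ^ 4 := inv_eq_self_of_sq (by rw [← pow_mul, h8])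
  constructor
  · refine Set.eq_singleton_iff_unique_mem.2 ⟨mul_zero _, fun r hr => ?_⟩
    classical
    -- As `h * g = g ^ 3 * h`, the element `h * g` occurs only once in the two products, with
    -- coefficient `r`.
    have := congrArg (fun t => t.coeff (h * g)) (H _ (torsion_single_mem_antisymmetric hh hh2 hr) _
      (add_inv_mem_antisymmetric hg))
    have e1 : h * g⁻¹ ≠ h * g := fun e => pow_two_ne_one hg4 (by
      rw [sq, mul_eq_one_iff_inv_eq]; exact mul_left_cancel e)
    have e2 : g * h ≠ h * g := fun e => hnc e.symm
    have e3 : g⁻¹ * h ≠ h * g := fun e => hg4 (by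
      rw [hhg.eq] at e
      rw [pow_succ', ← mul_right_cancel e, mul_inv_cancel])
    simpa only [mul_add, add_mul, MonoidAlgebra.single_mul_single, MonoidAlgebra.coeff_add,
      MonoidAlgebra.coeff_single, Finsupp.add_apply, Finsupp.single_apply, e1, e2, e3, if_true,
      if_false, mul_one, add_zero] using this
  · refine isModelProduct_of_generators hg hh (h8 g) hg4
      (by rw [← sq, hh2]; exact (pow_zero g).symm) hhg hnc
      (fun x hx => or_iff_not_imp_left.2 fun hxg => ?_)
      (fun x y hx hy hxg hyg =>
        commute_of_commute_order_eight H h2 h4 hg (h8 g) h8 hg4 hx hy hxg hyg)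
      hinv fun x hx hxg => or_iff_not_imp_left.2 fun hx2 => ?_
    · have := (hhg.pow_right 3).mul_left (cubes x hx hxg)
      rw [← pow_mul, show 3 * 3 = 8 + 1 from rfl, pow_succ, h8, one_mul] at this
      rwa [hhi]
    · have hxv : x * (g * h) = g * h * x⁻¹ := by
        rw [← mul_assoc, hxg.eq, mul_assoc, mul_assoc, (hinv x hx hxg).inv_right.eq, inv_inv]
      have hσ : σ (g * h) = -1 := by simp [hg, hh]
      have hne : x * (g * h) ≠ g * h * x := fun e => hx2 (by
        rw [hxv] at e
        rw [sq, mul_eq_one_iff_inv_eq]; exact mul_left_cancel e)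
      -- Since `g * h` inverts `x`, either alternative equates `x ^ 2` with `(g * h) ^ 2 = g ^ 4`.
      rcases mixed_relation H h2 hx hσ hx2 (by rwa [hv2]) hne with h1 | h1
      · rw [sq_eq_inv_sq_of_mul_eq h1, hv2, hg4inv]
      · rw [← hv2, sq x, eq_comm, ← mul_inv_eq_iff_eq_mul, sq, mul_assoc, ← hxv, h1,
          mul_inv_cancel_left]

theorem isModelProduct_of_antisymmetricCommutative (H : AntisymmetricCommutative R σ)
    (h2 : (2 : R) ≠ 0) (hG : ∃ x y : G, x * y ≠ y * x) (hexp : Monoid.exponent G = 8) (hσ : σ ≠ 1) :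
    (twoTorsion R = {0} ∧ IsModelProduct σ .semidihedral) ∨
      ((4 : R) = 0 ∧ IsModelProduct σ .quaternion) := by
  have h8 : ∀ x : G, x ^ 8 = 1 := fun x => by rw [← hexp, Monoid.pow_exponent_eq_one]
  obtain ⟨τ, hτ⟩ : ∃ τ, σ τ = -1 := by
    by_contra! h
    exact hσ (MonoidHom.ext fun x => (Int.units_eq_one_or _).resolve_right (h x))
  have h4 : ∀ x : G, σ x = 1 → x ^ 4 = 1 := fun x hx => pow_four_eq_one H h2 h8 hG hτ hx
  obtain ⟨g, hg4⟩ : ∃ g : G, g ^ 4 ≠ 1 := by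
    by_contra! h
    have := Monoid.exponent_dvd_of_forall_pow_eq_one h
    rw [hexp] at this
    exact absurd this (by decide)
  have hg : σ g = -1 := sigma_eq_neg_one fun h => hg4 (h4 g h)
  have hnc : ∃ h, σ h = 1 ∧ ¬ Commute h g := by
    by_contra! hc
    obtain ⟨x, y, hxy⟩ := hG
    refine hxy (commute_of_ker_central (σ := σ) (fun x hx y => ?_) x y)
    -- If all of `N` centralized `g`, then `N` would be abelian and, `G` being generated by `N` and
    -- `g`, central.
    have hN : ∀ y, σ y = 1 → Commute x y := fun y hy =>
      commute_of_commute_order_eight H h2 h4 hg (h8 g) h8 hg4 hx hy (hc x hx) (hc y hy)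
    by_cases hy : σ y = 1
    · exact hN y hy
    · have := (hN (y * g) (by simp [hg, sigma_eq_neg_one hy])).mul_right (hc x hx).inv_right
      rwa [mul_inv_cancel_right] at this
  by_cases hex : ∃ h, σ h = 1 ∧ ¬ Commute h g ∧ h ^ 2 ≠ 1
  · obtain ⟨h, hh, hhg, hh2⟩ := hex
    exact .inr (isModelProduct_quaternion_of_inverts H h2 h8 h4 hg hg4 hh hh2 hhg
      ((commute_or_semiconjBy_inv H h2 h4 hh hh2 hg hg4).resolve_left hhg))
  · push Not at hex
    obtain ⟨h, hh, hhg⟩ := hnc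
    exact .inl (isModelProduct_semidihedral_of_cubes H h2 h8 h4 hg hg4 hh (hex h hh hhg) hhg hex)

end Necessity

end OrientedGroupRing

theorem theorem4p1 {R : Type u} [CommRing R] [Nontrivial R] (hR : ringChar R ≠ 2)
    {G : Type v} [Group G] (hG : ∃ x y : G, x * y ≠ y * x) (hexp : Monoid.exponent G = 8)
    (σ : G →* ℤˣ) (hσ : σ ≠ 1) :
    OrientedGroupRing.AntisymmetricCommutative R σ ↔
      (OrientedGroupRing.twoTorsion R = {0} ∧
        ∃ (E : Type v) (_ : CommGroup E) (e : G ≃* OrientedGroupRing.G168 × E),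
          OrientedGroupRing.IsElementaryAbelianTwo E ∧
          σ.ker.map e.toMonoidHom =
            (Subgroup.closure {OrientedGroupRing.genG ^ 2,
              OrientedGroupRing.genG * OrientedGroupRing.genH}).prod ⊤) ∨
      (ringChar R = 4 ∧
        ∃ (E : Type v) (_ : CommGroup E) (e : G ≃* OrientedGroupRing.G169 × E),
          OrientedGroupRing.IsElementaryAbelianTwo E ∧
          (σ.ker.map e.toMonoidHom =
              (Subgroup.closure {OrientedGroupRing.genG ^ 2,
                OrientedGroupRing.genH}).prod ⊤ ∨
            σ.ker.map e.toMonoidHom =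
              (Subgroup.closure {OrientedGroupRing.genG ^ 2,
                OrientedGroupRing.genG * OrientedGroupRing.genH}).prod ⊤)) := by
  have h1 : ringChar R ≠ 1 := CharP.ringChar_ne_one
  have h2 : (2 : R) ≠ 0 := fun h => by
    have : ringChar R ∣ 2 := ringChar.dvd (by exact_mod_cast h)
    rcases (Nat.dvd_prime Nat.prime_two).1 this with h | h
    · exact h1 h
    · exact hR h
  have h4 : ringChar R = 4 ↔ (4 : R) = 0 := by
    constructor
    · intro h
      have := ringChar.Nat.cast_ringChar (R := R)
      rw [h] at this
      exact_mod_cast this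
    · intro h
      have h' : ringChar R ∣ 2 ^ 2 := ringChar.dvd (by norm_num; exact h)
      obtain ⟨k, hk, hk'⟩ := (Nat.dvd_prime_pow Nat.prime_two).1 h'
      interval_cases k
      · exact absurd hk' h1
      · exact absurd hk' hR
      · exact hk'
  rw [← OrientedGroupRing.isModelProduct_semidihedral_iff hσ,
    ← OrientedGroupRing.isModelProduct_quaternion_iff hσ, h4]
  constructor
  · intro H
    exact OrientedGroupRing.isModelProduct_of_antisymmetricCommutative H h2 hG hexp hσ
  · rintro (⟨h, h'⟩ | ⟨h, h'⟩)
    · exact OrientedGroupRing.antisymmetricCommutative_of_isModelProduct h' (.inl ⟨rfl, h⟩)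
    · exact OrientedGroupRing.antisymmetricCommutative_of_isModelProduct h' (.inr ⟨rfl, h⟩)
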